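/- Let $T$ be a complete first-order theory (one home sort) and let $\mathcal C\models T$ be a monster model: for some uncountable cardinal $\kappa>|L|$, $\mathcal C$ is $\kappa$-saturated and every elementary map between subsets of $\mathcal C$ with fewer than $\kappa$ elements extends to an automorphism of $\mathcal C$. "Small" means of cardinality $<\kappa$. Tuples are finite tuples of elements of $\mathcal C^{eq}$, and types and formulas are taken in $\mathcal C^{eq}$. Definitions. A formula $\delta(x,a)$ *strongly divides* over $A\subseteq\mathcal C^{eq}$ if $tp(a/A)$ is non-algebraic and, for some $k\in\mathbb N$, the family $\{\delta(x,a')\}_{a'\models tp(a/A)}$ is $k$-inconsistent; it *þ-divides* over $A$ if it strongly divides over $Ac$ for some tuple $c$. A formula *þ-forks* over $A$ if it implies a finite disjunction of formulas (with arbitrary parameters) that þ-divide over $A$; a type þ-forks over $A$ if it contains a formula that does. For a tuple $a$ and a set $A$, the rank $U^{þ}(a/A)$ of $tp(a/A)$ is defined by: $U^{þ}(a/A)\ge\alpha$ iff for every $\beta<\alpha$ there are a small $B\supseteq A$ and $b\models tp(a/A)$ such that $tp(b/B)$ þ-forks over $A$ and $U^{þ}(b/B)\ge\beta$. For a formula $\varphi(x)$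 with parameters, finite sets $\Delta$ of formulas $\delta(x;y)$ and $\Pi$ of formulas $\pi(y;z)$ without parameters, and $k\in\mathbb N$, the þ-rank is defined by: $þ(\varphi,\Delta,\Pi,k)\ge\alpha$ iff $\varphi$ is consistent and for every $\beta<\alpha$ there are $\delta\in\Delta$, $\pi\in\Pi$ and parameters $c$ such that $\{\delta(x,a)\}_{a\models\pi(y;c)}$ is $k$-inconsistent and $þ(\varphi\wedge\delta(x,a),\Delta,\Pi,k)\ge\beta$ for infinitely many $a\models\pi(y;c)$. $T$ is *rosy* if all þ-ranks are ordinals (never $\infty$), and *superrosy* if it is rosy and $U^{þ}(a/A)$ is an ordinal for every tuple $a$ of $\mathcal C^{eq}$ and every small $A\subseteq\mathcal C^{eq}$. $T$ is *þ-minimal* if for every single element $a\in\mathcal C\setminus acl(\emptyset)$ and every small $A\subseteq\mathcal C$, $tp(a/A)$ þ-forks over $\emptyset$ if and only if $a\in acl(A)$. Statement. If $U^{þ}(a/A)\le 1$ for every single element $a\in\mathcal C$ of the home sort and every small set $A\subseteq\mathcal C$, then $T$ is superrosy. In particular, if $T$ is þ-minimal, then $T$ is superrosy. -/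

import Mathlib

open FirstOrder Cardinal

universe u v w

namespace Thorn

/-! ### Monster models -/

/-- `C` is a monster model with smallness bound `κ`: `κ` is uncountable and larger than the
language, `C` is `κ`-saturated (every finitely satisfiable family of subsets of `C` definable over
a fixed set of fewer than `κ` parameters has a common point), and `C` is strongly `κ`-homogeneous
(every elementary map defined on fewer than `κ` elements extends to an automorphism). -/
structure IsMonster (L : FirstOrder.Language.{u, v}) (C : Type w) [L.Structure C] (κ : Cardinal.{w}) :
    Prop where
  aleph0_lt : ℵ₀ < κ
  card_lt : Cardinal.lift.{w} L.card < Cardinal.lift.{max u v} κ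
  saturated : ∀ A : Set C, #A < κ → ∀ F : Set (Set C), (∀ X ∈ F, A.Definable₁ L X) →
    (∀ G : Finset (Set C), (G : Set (Set C)) ⊆ F → (⋂₀ (G : Set (Set C))).Nonempty) →
      (⋂₀ F).Nonempty
  homogeneous : ∀ A : Set C, #A < κ → ∀ f : A → C,
    (∀ φ : L.Formula A, φ.Realize (fun a : A => (a : C)) ↔ φ.Realize f) →
      ∃ g : C ≃[L] C, ∀ a : A, g a = f a

/-! ### Imaginaries

A sort of `C^eq` is given by a parameter-free formula which defines an equivalence relation on a
finite power of `C`; its elements are the equivalence classes. -/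

/-- A sort of `C^eq`. -/
structure EqSort (L : FirstOrder.Language.{u, v}) (C : Type w) [L.Structure C] : Type (max u v) where
  arity : ℕ
  rel : L.Formula (Fin arity ⊕ Fin arity)
  equiv : Equivalence fun a b : Fin arity → C => rel.Realize (Sum.elim a b)

section

variable {L : FirstOrder.Language.{u, v}} {C : Type w} [L.Structure C]

/-- The equivalence relation of a sort. -/
def EqSort.setoid (S : EqSort L C) : Setoid (Fin S.arity → C) where
  r a b := S.rel.Realize (Sum.elim a b)
  iseqv := S.equiv

/-- The set of elements of a sort of `C^eq`. -/
def EqSort.Carrier (S : EqSort L C) : Type w := Quotient S.setoid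

variable (L C) in
/-- The set of all elements of `C^eq`. -/
abbrev Imag : Type (max u v w) := Σ S : EqSort L C, S.Carrier

/-- Finite tuples of imaginaries, the `i`-th entry being of sort `s i`. -/
abbrev Tuple {m : ℕ} (s : Fin m → EqSort L C) : Type w := ∀ i, (s i).Carrier

/-- The coordinates of a real tuple which represents a tuple of imaginaries of sorts `s`. -/
abbrev Coord {m : ℕ} (s : Fin m → EqSort L C) : Type := Σ i, Fin (s i).arity

/-- The tuple of imaginaries represented by a real tuple. -/
def Tuple.mk {m : ℕ} (s : Fin m → EqSort L C) (v : Coord s → C) : Tuple s :=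
  fun i => Quotient.mk (s i).setoid fun j => v ⟨i, j⟩

/-- The set of the entries of a tuple of imaginaries. -/
def Tuple.entries {m : ℕ} {s : Fin m → EqSort L C} (a : Tuple s) : Set (Imag L C) :=
  Set.range fun i => (⟨s i, a i⟩ : Imag L C)

/-- The relation `R(x; y)` between tuples of imaginaries is defined in `C^eq` by a formula without
parameters. The parameter-free definable relations of `C^eq` are those whose preimage in the real
sort is definable in `C` without parameters. -/
def IsFormula {m n : ℕ} {s : Fin m → EqSort L C} {t : Fin n → EqSort L C}
    (R : Tuple s → Tuple t → Prop) : Prop :=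
  (∅ : Set C).Definable L {v : Coord s ⊕ Coord t → C |
    R (Tuple.mk s fun p => v (Sum.inl p)) (Tuple.mk t fun q => v (Sum.inr q))}

/-- `X` is the solution set of a formula with parameters from `A ⊆ C^eq`. -/
def DefinableOver (A : Set (Imag L C)) {m : ℕ} {s : Fin m → EqSort L C} (X : Set (Tuple s)) :
    Prop :=
  ∃ (n : ℕ) (t : Fin n → EqSort L C) (e : Tuple t) (R : Tuple s → Tuple t → Prop),
    e.entries ⊆ A ∧ IsFormula R ∧ X = {x | R x e}

/-- `tp(a/A) = tp(b/A)`. -/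
def SameType (A : Set (Imag L C)) {m : ℕ} {s : Fin m → EqSort L C} (a b : Tuple s) : Prop :=
  ∀ X : Set (Tuple s), DefinableOver A X → (a ∈ X ↔ b ∈ X)

/-- `tp(a/A)` is algebraic: it contains a formula with only finitely many solutions. -/
def IsAlgebraicOver (A : Set (Imag L C)) {m : ℕ} {s : Fin m → EqSort L C} (a : Tuple s) : Prop :=
  ∃ X : Set (Tuple s), DefinableOver A X ∧ X.Finite ∧ a ∈ X

/-! ### Thorn-forking -/

/-- The family `{δ(x, a)}`, `a ∈ Y`, is `k`-inconsistent. -/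
def KInconsistent {m n : ℕ} {s : Fin m → EqSort L C} {t : Fin n → EqSort L C}
    (δ : Tuple s → Tuple t → Prop) (Y : Set (Tuple t)) (k : ℕ) : Prop :=
  ∀ F : Finset (Tuple t), (F : Set (Tuple t)) ⊆ Y → F.card = k → ¬ ∃ x, ∀ a ∈ F, δ x a

/-- The formula `δ(x, a)` strongly divides over `A`. -/
def StronglyDivides (A : Set (Imag L C)) {m n : ℕ} {s : Fin m → EqSort L C}
    {t : Fin n → EqSort L C} (δ : Tuple s → Tuple t → Prop) (a : Tuple t) : Prop :=
  ¬ IsAlgebraicOver A a ∧ ∃ k : ℕ, KInconsistent δ {a' | SameType A a a'} k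

/-- The formula `δ(x, a)` thorn-divides over `A`. -/
def ThornDivides (A : Set (Imag L C)) {m n : ℕ} {s : Fin m → EqSort L C}
    {t : Fin n → EqSort L C} (δ : Tuple s → Tuple t → Prop) (a : Tuple t) : Prop :=
  ∃ (l : ℕ) (r : Fin l → EqSort L C) (c : Tuple r), StronglyDivides (A ∪ c.entries) δ a

/-- The formula with solution set `X` thorn-forks over `A`: it implies a finite disjunction of
formulas which thorn-divide over `A`. -/
def ThornForks (A : Set (Imag L C)) {m : ℕ} {s : Fin m → EqSort L C} (X : Set (Tuple s)) : Prop :=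
  ∃ (N : ℕ) (n : Fin N → ℕ) (t : ∀ i, Fin (n i) → EqSort L C)
    (δ : ∀ i, Tuple s → Tuple (t i) → Prop) (a : ∀ i, Tuple (t i)),
    (∀ i, IsFormula (δ i) ∧ ThornDivides A (δ i) (a i)) ∧ ∀ x ∈ X, ∃ i, δ i x (a i)

/-- `tp(a/B)` thorn-forks over `A`. -/
def TypeThornForks (A B : Set (Imag L C)) {m : ℕ} {s : Fin m → EqSort L C} (a : Tuple s) : Prop :=
  ∃ X : Set (Tuple s), DefinableOver B X ∧ a ∈ X ∧ ThornForks A X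

/-! ### The rank `U^þ` -/

/-- A subset of `C^eq` is small if it has fewer than `κ` elements. -/
def IsSmall (κ : Cardinal.{w}) (A : Set (Imag L C)) : Prop :=
  #A < Cardinal.lift.{max u v} κ

/-- `U^þ(tp(a/A)) ≥ α`: for every `β < α` the type `tp(a/A)` has a thorn-forking extension `tp(b/B)`
over a small set `B ⊇ A` with `U^þ(tp(b/B)) ≥ β`. -/
def UThornGE (κ : Cardinal.{w}) (α : Ordinal.{max u v w}) {m : ℕ} {s : Fin m → EqSort L C}
    (a : Tuple s) (A : Set (Imag L C)) : Prop :=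
  ∀ β, β < α → ∃ (B : Set (Imag L C)) (b : Tuple s), A ⊆ B ∧ IsSmall κ B ∧ SameType A a b ∧
    TypeThornForks A B b ∧ UThornGE κ β b B
termination_by α

/-- `U^þ(tp(a/A)) ≤ α`. -/
def UThornLE (κ : Cardinal.{w}) (α : Ordinal.{max u v w}) {m : ℕ} {s : Fin m → EqSort L C}
    (a : Tuple s) (A : Set (Imag L C)) : Prop :=
  ¬ UThornGE.{u, v, w} κ (α + 1) a A

/-! ### Thorn-ranks, rosy and superrosy theories -/

/-- `þ(X, Δ, Π, k) ≥ α`, for a formula with solution set `X`: `X` is nonempty and for every `β < α`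
there are `δ ∈ Δ`, `π ∈ Π` and `c` such that `þ(X ∧ δ(x, a), Δ, Π, k) ≥ β` for infinitely many
`a ⊨ π(y; c)` and `{δ(x, a)}`, `a ⊨ π(y; c)`, is `k`-inconsistent. -/
def ThornRankGE {m n l : ℕ} {s : Fin m → EqSort L C} {t : Fin n → EqSort L C}
    {r : Fin l → EqSort L C} (Δ : Set (Tuple s → Tuple t → Prop))
    (P : Set (Tuple t → Tuple r → Prop)) (k : ℕ) (α : Ordinal.{max u v w}) (X : Set (Tuple s)) :
    Prop :=
  X.Nonempty ∧ ∀ β, β < α → ∃ δ ∈ Δ, ∃ π ∈ P, ∃ c : Tuple r,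
    {a | π a c ∧ ThornRankGE Δ P k β (X ∩ {x | δ x a})}.Infinite ∧
      KInconsistent δ {a | π a c} k
termination_by α

variable (L C) in
/-- The theory of the monster model `C` is rosy: all thorn-ranks `þ(φ, Δ, Π, k)`, with `Δ` and `Π`
finite sets of formulas, are ordinals. -/
def IsRosy : Prop :=
  ∀ (m n l : ℕ) (s : Fin m → EqSort L C) (t : Fin n → EqSort L C) (r : Fin l → EqSort L C)
    (Δ : Set (Tuple s → Tuple t → Prop)) (P : Set (Tuple t → Tuple r → Prop)) (k : ℕ)
    (X : Set (Tuple s)), Δ.Finite → P.Finite → (∀ δ ∈ Δ, IsFormula δ) → (∀ π ∈ P, IsFormula π) →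
      DefinableOver Set.univ X → ∃ α : Ordinal.{max u v w}, ¬ ThornRankGE Δ P k α X

variable (L C) in
/-- The theory of the monster model `C` is superrosy: it is rosy and `U^þ(tp(a/A))` is an ordinal
for every finite tuple `a` of imaginaries and every small set `A` of imaginaries. -/
def IsSuperrosy (κ : Cardinal.{w}) : Prop :=
  IsRosy L C ∧ ∀ (m : ℕ) (s : Fin m → EqSort L C) (a : Tuple s) (A : Set (Imag L C)),
    IsSmall κ A → ∃ α : Ordinal.{max u v w}, ¬ UThornGE κ α a A

/-! ### Real elements and thorn-minimality -/

variable (L C) in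
/-- The home sort, that is `C` itself as a sort of `C^eq`. -/
def homeSort : EqSort L C where
  arity := 1
  rel := FirstOrder.Language.Term.equal (FirstOrder.Language.Term.var (Sum.inl 0)) (FirstOrder.Language.Term.var (Sum.inr 0))
  equiv := by
    simp only [FirstOrder.Language.Formula.realize_equal, FirstOrder.Language.Term.realize_var, Sum.elim_inl,
      Sum.elim_inr]
    exact ⟨fun _ => rfl, fun h => h.symm, fun h h' => h.trans h'⟩

variable (L) in
/-- An element of `C` as an element of the home sort of `C^eq`. -/
def toHome (a : C) : (homeSort L C).Carrier :=
  Quotient.mk (homeSort L C).setoid fun _ => a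

variable (L) in
/-- An element of `C` as a tuple of length one in `C^eq`. -/
def single (a : C) : Tuple (fun _ : Fin 1 => homeSort L C) := fun _ => toHome L a

variable (L) in
/-- A subset of `C` as a subset of `C^eq`. -/
def realSet (A : Set C) : Set (Imag L C) := (fun a => ⟨homeSort L C, toHome L a⟩) '' A

variable (L C) in
/-- The theory of the monster model `C` is thorn-minimal: for every single element `a` of `C` that
is not algebraic over `∅` and every small `A ⊆ C`, `tp(a/A)` thorn-forks over `∅` if and only if
`a` is algebraic over `A`. -/
def IsThornMinimal (κ : Cardinal.{w}) : Prop :=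
  ∀ (a : C) (A : Set C), #A < κ → ¬ IsAlgebraicOver (∅ : Set (Imag L C)) (single L a) →
    (TypeThornForks ∅ (realSet L A) (single L a) ↔ IsAlgebraicOver (realSet L A) (single L a))

end

end Thorn

/-! Everything passes through one exchange property (`HasExchange`): over a small set S of real
parameters, if a is a single real element and d an element of any interpreted sort with d in acl(Sa)
but not in acl(S), then a is in acl(Sd).

If exchange fails, both hypotheses fail. A formula witnessing d ∈ acl(Sa) can be chosen with a
uniform bound on its solutions in d; read as a formula in a, it þ-divides over S, since d is not
algebraic over S. As a ∉ acl(Sd), a suitable conjugate of a is non-algebraic over a small real set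
S' ⊇ S representing d, while its type over S' þ-forks over S and also over ∅
(`IsMonster.exists_forks_of_not_hasExchange`). This refutes þ-minimality. Adjoining the conjugate
itself to S' is a second forking step, so its U^þ over S is at least 2.

If exchange holds, let `rk A n a` count the entries of a real tuple that are not algebraic over A
and the earlier entries. Making known a point d that is algebraic over A and the tuple, but not over
A, lowers this count (`HasExchange.rk_lt`). A þ-forking extension makes such a d known, so U^þ is
bounded by `rk` of a representing real tuple. Each step of a þ-rank does so as well, once saturation
has turned "infinitely many instances" into a non-algebraic one (`HasExchange.exists_le_rk`). Hence
both ranks are finite, bounded by the number of real coordinates. -/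

namespace Thorn

/-! ### Interpreted sorts -/

section Spaces

variable (L : FirstOrder.Language.{u, v}) (C : Type w) [L.Structure C]

/-- A type which is the quotient of a finite power of `C` by a parameter-free definable equivalence
relation. -/
class EqSpace (α : Type w) where
  idx : Type
  finite_idx : Finite idx
  ofRep : (idx → C) → α
  ofRep_surjective : Function.Surjective ofRep
  exists_ker : ∃ φ : L.Formula (idx ⊕ idx), ∀ v w : idx → C,
    φ.Realize (Sum.elim v w) ↔ ofRep v = ofRep w

attribute [instance] EqSpace.finite_idx

instance EqSpace.self : EqSpace L C C where
  idx := Unit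
  finite_idx := inferInstance
  ofRep v := v ()
  ofRep_surjective c := ⟨fun _ => c, rfl⟩
  exists_ker := ⟨FirstOrder.Language.Term.equal (FirstOrder.Language.Term.var (Sum.inl ()))
    (FirstOrder.Language.Term.var (Sum.inr ())), fun v w => by simp⟩

/-- The sort of the empty tuple; as a base point in `Acl` it expresses algebraicity over the
parameter set alone. -/
instance EqSpace.punit : EqSpace L C PUnit.{w + 1} where
  idx := Empty
  finite_idx := inferInstance
  ofRep _ := PUnit.unit
  ofRep_surjective _ := ⟨Empty.elim, rfl⟩
  exists_ker := ⟨⊤, fun v w => by simp⟩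

variable {L C} in
instance EqSpace.carrier (S : EqSort L C) : EqSpace L C S.Carrier where
  idx := Fin S.arity
  finite_idx := inferInstance
  ofRep := Quotient.mk S.setoid
  ofRep_surjective := Quotient.mk_surjective
  exists_ker := ⟨S.rel, fun v w => (Quotient.eq (r := S.setoid) (x := v) (y := w)).symm⟩

instance EqSpace.pi {ι : Type} [Finite ι] (α : ι → Type w) [∀ i, EqSpace L C (α i)] :
    EqSpace L C (∀ i, α i) where
  idx := Σ i, idx L C (α i)
  finite_idx := inferInstance
  ofRep v := fun i => ofRep (L := L) fun j => v ⟨i, j⟩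
  ofRep_surjective x := by
    choose v hv using fun i => ofRep_surjective (L := L) (C := C) (x i)
    exact ⟨fun p => v p.1 p.2, funext hv⟩
  exists_ker := by
    choose φ hφ using fun i => exists_ker (L := L) (C := C) (α := α i)
    refine ⟨FirstOrder.Language.Formula.iInf fun i =>
      (φ i).relabel (Sum.map (Sigma.mk i) (Sigma.mk i)), fun v w => ?_⟩
    rw [funext_iff]
    simp only [FirstOrder.Language.Formula.realize_iInf, FirstOrder.Language.Formula.realize_relabel,
      Sum.elim_comp_map, hφ]
    rfl

instance EqSpace.prod (α β : Type w) [EqSpace L C α] [EqSpace L C β] : EqSpace L C (α × β) where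
  idx := idx L C α ⊕ idx L C β
  finite_idx := inferInstance
  ofRep v := (ofRep (L := L) (v ∘ Sum.inl), ofRep (L := L) (v ∘ Sum.inr))
  ofRep_surjective x := by
    obtain ⟨v, hv⟩ := ofRep_surjective (L := L) (C := C) x.1
    obtain ⟨w, hw⟩ := ofRep_surjective (L := L) (C := C) x.2
    exact ⟨Sum.elim v w, Prod.ext hv hw⟩
  exists_ker := by
    obtain ⟨φ, hφ⟩ := exists_ker (L := L) (C := C) (α := α)
    obtain ⟨ψ, hψ⟩ := exists_ker (L := L) (C := C) (α := β)
    refine ⟨φ.relabel (Sum.map Sum.inl Sum.inl) ⊓ ψ.relabel (Sum.map Sum.inr Sum.inr),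
      fun v w => ?_⟩
    simp [FirstOrder.Language.Formula.realize_relabel, Sum.elim_comp_map, hφ, hψ]

/-- A map between interpreted sorts which only rearranges the coordinates of representatives. -/
@[fun_prop]
def IsProj {α β : Type w} [EqSpace L C α] [EqSpace L C β] (f : α → β) : Prop :=
  ∃ σ : EqSpace.idx L C β → EqSpace.idx L C α, ∀ v : EqSpace.idx L C α → C,
    f (EqSpace.ofRep (L := L) v) = EqSpace.ofRep (L := L) (v ∘ σ)

variable {α β γ : Type w} [EqSpace L C α] [EqSpace L C β] [EqSpace L C γ]

namespace IsProj

@[fun_prop]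
theorem id' : IsProj L C (fun x : α => x) := ⟨id, fun _ => rfl⟩

@[fun_prop]
theorem comp {f : β → γ} {g : α → β} (hf : IsProj L C f) (hg : IsProj L C g) :
    IsProj L C fun x => f (g x) := by
  obtain ⟨σ, hσ⟩ := hf
  obtain ⟨τ, hτ⟩ := hg
  exact ⟨τ ∘ σ, fun v => by beta_reduce; rw [hτ, hσ]; rfl⟩

@[fun_prop]
theorem fst {f : α → β × γ} (hf : IsProj L C f) : IsProj L C fun x => (f x).1 :=
  comp L C (f := Prod.fst) ⟨Sum.inl, fun _ => rfl⟩ hf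

@[fun_prop]
theorem snd {f : α → β × γ} (hf : IsProj L C f) : IsProj L C fun x => (f x).2 :=
  comp L C (f := Prod.snd) ⟨Sum.inr, fun _ => rfl⟩ hf

@[fun_prop]
theorem prodMk {f : α → β} {g : α → γ} (hf : IsProj L C f) (hg : IsProj L C g) :
    IsProj L C fun x => (f x, g x) := by
  obtain ⟨σ, hσ⟩ := hf
  obtain ⟨τ, hτ⟩ := hg
  exact ⟨Sum.elim σ τ, fun v => Prod.ext (hσ v) (hτ v)⟩

@[fun_prop]
theorem apply {ι : Type} [Finite ι] {α' : ι → Type w} [∀ i, EqSpace L C (α' i)] (i : ι) :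
    IsProj L C fun x : ∀ i, α' i => x i :=
  ⟨fun j => ⟨i, j⟩, fun _ => rfl⟩

@[fun_prop]
theorem pi {ι : Type} [Finite ι] {α' : ι → Type w} [∀ i, EqSpace L C (α' i)]
    {f : α → ∀ i, α' i} (hf : ∀ i, IsProj L C fun x => f x i) : IsProj L C f := by
  choose σ hσ using hf
  exact ⟨fun p => σ p.1 p.2, fun v => funext fun i => hσ i v⟩

end IsProj

end Spaces

/-! ### Definability over a set of imaginaries -/

section Definability

variable {L : FirstOrder.Language.{u, v}} {C : Type w} [L.Structure C]

/-- The coordinates of representatives of the elements of a set of imaginaries. -/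
abbrev ParamVar (A : Set (Imag L C)) : Type max u v w := Σ e : A, Fin e.1.1.arity

/-- An assignment of a representative to every element of `A`. -/
def IsRep {A : Set (Imag L C)} (p : ParamVar A → C) : Prop :=
  ∀ e : A, (Quotient.mk e.1.1.setoid fun j => p ⟨e, j⟩) = e.1.2

theorem exists_isRep (A : Set (Imag L C)) : ∃ p : ParamVar A → C, IsRep p := by
  choose p hp using fun e : A => Quotient.mk_surjective (s := e.1.1.setoid) e.1.2
  exact ⟨fun q => p q.1 q.2, hp⟩

/-- `P` is definable over `A` in `C^eq`. -/
def Defin (A : Set (Imag L C)) {α : Type w} [EqSpace L C α] (P : α → Prop) : Prop :=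
  ∃ φ : L.Formula (EqSpace.idx L C α ⊕ ParamVar A), ∀ p, IsRep p → ∀ v,
    P (EqSpace.ofRep v) ↔ φ.Realize (Sum.elim v p)

variable {A B : Set (Imag L C)} {α β γ : Type w} [EqSpace L C α] [EqSpace L C β] [EqSpace L C γ]

namespace Defin

theorem congr {P Q : α → Prop} (h : Defin A P) (e : ∀ x, Q x ↔ P x) : Defin A Q := by
  rwa [show Q = P from funext fun x => propext (e x)]

theorem mono {P : α → Prop} (h : Defin A P) (hAB : A ⊆ B) : Defin B P := by
  obtain ⟨φ, hφ⟩ := h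
  let f : ParamVar A → ParamVar B := fun q => ⟨⟨q.1.1, hAB q.1.2⟩, q.2⟩
  refine ⟨φ.relabel (Sum.map id f), fun p hp v => ?_⟩
  rw [FirstOrder.Language.Formula.realize_relabel, Sum.elim_comp_map, Function.comp_id]
  exact hφ _ (fun e => hp ⟨e.1, hAB e.2⟩) v

theorem not {P : α → Prop} (h : Defin A P) : Defin A fun x => ¬ P x := by
  obtain ⟨φ, hφ⟩ := h
  exact ⟨φ.not, fun p hp v => by simp only [FirstOrder.Language.Formula.realize_not, hφ p hp]⟩

theorem all {ι : Type*} [Finite ι] {P : ι → α → Prop} (h : ∀ i, Defin A (P i)) :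
    Defin A fun x => ∀ i, P i x := by
  choose φ hφ using h
  exact ⟨FirstOrder.Language.Formula.iInf φ, fun p hp v => by
    simp only [FirstOrder.Language.Formula.realize_iInf, fun i => hφ i p hp]⟩

theorem any {ι : Type*} [Finite ι] {P : ι → α → Prop} (h : ∀ i, Defin A (P i)) :
    Defin A fun x => ∃ i, P i x :=
  (all fun i => (h i).not).not.congr fun x => by simp

theorem and {P Q : α → Prop} (hP : Defin A P) (hQ : Defin A Q) : Defin A fun x => P x ∧ Q x :=
  (all (ι := Bool) (P := fun b => if b then P else Q)
    (by rintro (_ | _) <;> simpa)).congr fun x => by simp [and_comm]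

theorem const (p : Prop) : Defin A fun _ : α => p := by
  by_cases h : p
  · exact (all (ι := Empty) (P := fun _ _ => True) (by simp)).congr fun x => by simp [h]
  · exact (all (ι := Empty) (P := fun _ _ => True) (by simp)).not.congr fun x => by simp [h]

theorem ex {P : α → β → Prop} (h : Defin A fun p : α × β => P p.1 p.2) :
    Defin A fun x => ∃ y, P x y := by
  obtain ⟨φ, hφ⟩ := h
  let ρ : (EqSpace.idx L C α ⊕ EqSpace.idx L C β) ⊕ ParamVar A →
      (EqSpace.idx L C α ⊕ ParamVar A) ⊕ EqSpace.idx L C β :=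
    Sum.elim (Sum.elim (Sum.inl ∘ Sum.inl) Sum.inr) (Sum.inl ∘ Sum.inr)
  have hρ : ∀ v p w, Sum.elim (Sum.elim v p) w ∘ ρ = Sum.elim (Sum.elim v w) (p : _ → C) := by
    intro v p w
    funext x
    rcases x with (_ | _) | _ <;> rfl
  refine ⟨(FirstOrder.Language.Formula.relabel ρ φ).iExs _, fun p hp v => ?_⟩
  simp only [FirstOrder.Language.Formula.realize_iExs,
    FirstOrder.Language.Formula.realize_relabel, hρ,
    (EqSpace.ofRep_surjective (L := L) (C := C) (α := β)).exists]
  exact exists_congr fun w => hφ _ hp (Sum.elim v w)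

theorem comp {P : β → Prop} (h : Defin A P) {f : α → β} (hf : IsProj L C f) :
    Defin A fun x => P (f x) := by
  obtain ⟨φ, hφ⟩ := h
  obtain ⟨σ, hσ⟩ := hf
  refine ⟨FirstOrder.Language.Formula.relabel (Sum.map σ id) φ, fun p hp v => ?_⟩
  rw [FirstOrder.Language.Formula.realize_relabel, Sum.elim_comp_map, Function.comp_id]
  beta_reduce
  rw [hσ]
  exact hφ _ hp _

theorem eq {f g : α → β} (hf : IsProj L C f) (hg : IsProj L C g) :
    Defin A fun x => f x = g x := by
  refine comp (P := fun p : β × β => p.1 = p.2) (f := fun x => (f x, g x)) ?_ (by fun_prop)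
  obtain ⟨φ, hφ⟩ := EqSpace.exists_ker (L := L) (C := C) (α := β)
  refine ⟨φ.relabel Sum.inl, fun p _ v => ?_⟩
  rw [FirstOrder.Language.Formula.realize_relabel, Sum.elim_comp_inl]
  have := hφ (v ∘ Sum.inl) (v ∘ Sum.inr)
  rw [Sum.elim_comp_inl_inr] at this
  exact this.symm

/-- Substituting parameters from `A`. -/
theorem fiber {n : ℕ} {t : Fin n → EqSort L C} {P : α → Tuple t → Prop}
    (h : Defin A fun p : α × Tuple t => P p.1 p.2) {e : Tuple t} (he : e.entries ⊆ A) :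
    Defin A fun x => P x e := by
  obtain ⟨φ, hφ⟩ := h
  -- The formula gives the same answer for all representatives, so those of `e` can be read off the
  -- parameter variables.
  let k : EqSpace.idx L C (Tuple t) → ParamVar A := fun q => ⟨⟨⟨t q.1, e q.1⟩, he ⟨q.1, rfl⟩⟩, q.2⟩
  refine ⟨FirstOrder.Language.Formula.relabel
    (Sum.elim (Sum.elim Sum.inl (Sum.inr ∘ k)) Sum.inr) φ, fun p hp v => ?_⟩
  rw [FirstOrder.Language.Formula.realize_relabel]
  have h₁ : EqSpace.ofRep (L := L) (C := C) (α := Tuple t) (p ∘ k) = e :=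
    funext fun i => hp ⟨⟨t i, e i⟩, he ⟨i, rfl⟩⟩
  have h₂ := hφ p hp (Sum.elim v (p ∘ k))
  change P (EqSpace.ofRep v) (EqSpace.ofRep (p ∘ k)) ↔ _ at h₂
  rw [h₁] at h₂
  refine h₂.trans ?_
  congr! 1
  funext x
  rcases x with (_ | _) | _ <;> rfl

/-- An arbitrary formula on representatives need not respect the equivalence relation; quantifying
over representatives makes it do so. -/
theorem of_formula (ψ : L.Formula (EqSpace.idx L C α)) :
    Defin A fun x : α => ∃ v, EqSpace.ofRep v = x ∧ ψ.Realize v := by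
  refine ex (P := fun (x : α) (v : EqSpace.idx L C α → C) => EqSpace.ofRep v = x ∧ ψ.Realize v)
    ((eq (f := fun p : α × (EqSpace.idx L C α → C) => (EqSpace.ofRep p.2 : α))
      (IsProj.comp L C (f := fun v : EqSpace.idx L C α → C => (EqSpace.ofRep v : α))
        ⟨fun i => ⟨i, ()⟩, fun _ => rfl⟩ (by fun_prop)) (by fun_prop)).and
    (comp (P := fun v : EqSpace.idx L C α → C => ψ.Realize v) ?_ (by fun_prop)))
  refine ⟨FirstOrder.Language.Formula.relabel (fun i => Sum.inl ⟨i, ()⟩) ψ, fun p _ v => ?_⟩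
  rw [FirstOrder.Language.Formula.realize_relabel]
  rfl

/-- A formula has finitely many free variables, so it involves the coordinates of finitely many
imaginaries only, and these form the tuple `e`. -/
theorem exists_formula {P : α → Prop} (h : Defin A P) :
    ∃ (n : ℕ) (t : Fin n → EqSort L C) (e : Tuple t) (R : α → Tuple t → Prop), e.entries ⊆ A ∧
      Defin (∅ : Set (Imag L C)) (fun p : α × Tuple t => R p.1 p.2) ∧ ∀ x, P x ↔ R x e := by
  classical
  obtain ⟨φ, hφ⟩ := h
  let T : Finset A := φ.freeVarFinset.toRight.image Sigma.fst
  let l := T.equivFin.symm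
  let t : Fin T.card → EqSort L C := fun k => (l k).1.1.1
  let h : Coord t → ParamVar A := fun q => ⟨(l q.1).1, q.2⟩
  have hh : Function.Injective h := by
    rintro ⟨i, j⟩ ⟨i', j'⟩ hq
    have h₁ := congrArg Sigma.fst hq
    obtain rfl : i = i' := l.injective (Subtype.ext h₁)
    simpa [h] using hq
  have hf : ∀ x : φ.freeVarFinset, ∃ y : EqSpace.idx L C α ⊕ Coord t, Sum.map id h y = x := by
    rintro ⟨x | ⟨e, j⟩, hx⟩
    · exact ⟨Sum.inl x, rfl⟩
    · have he : e ∈ T := Finset.mem_image.2 ⟨⟨e, j⟩, Finset.mem_toRight.2 hx, rfl⟩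
      obtain ⟨k, hk⟩ := l.surjective ⟨e, he⟩
      obtain rfl : (l k).1 = e := by rw [hk]
      exact ⟨Sum.inr ⟨k, j⟩, rfl⟩
  choose f hf using hf
  have key : ∀ v w, (φ.restrictFreeVar f).Realize (Sum.elim v (w ∘ h)) (default : Fin 0 → C) ↔
      φ.Realize (Sum.elim v w) := fun v w =>
    FirstOrder.Language.BoundedFormula.realize_restrictFreeVar (Sum.elim v w) fun a => by
      rw [← hf a]
      rcases f a with _ | _ <;> rfl
  let ψ : L.Formula (EqSpace.idx L C (α × Tuple t)) := φ.restrictFreeVar f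
  refine ⟨T.card, t, fun k => (l k).1.1.2,
    fun x y => ∃ v, EqSpace.ofRep v = (x, y) ∧ ψ.Realize v, ?_, of_formula ψ, fun x => ?_⟩
  · rintro _ ⟨k, rfl⟩
    exact (l k).1.2
  · obtain ⟨w, hw⟩ := exists_isRep A
    constructor
    · intro hx
      obtain ⟨v, rfl⟩ := EqSpace.ofRep_surjective (L := L) (C := C) x
      exact ⟨Sum.elim v (w ∘ h), Prod.ext rfl (funext fun k => hw (l k).1),
        (key v w).2 ((hφ w hw v).1 hx)⟩
    · rintro ⟨v, hv, hψ⟩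
      obtain ⟨v, u, rfl⟩ : ∃ v' u, v = Sum.elim v' u :=
        ⟨v ∘ Sum.inl, v ∘ Sum.inr, (Sum.elim_comp_inl_inr v).symm⟩
      have hx : EqSpace.ofRep v = x := congrArg Prod.fst hv
      have hu : ∀ k, (Quotient.mk (t k).setoid fun j => u ⟨k, j⟩) = (l k).1.1.2 := fun k =>
        congrFun (congrArg Prod.snd hv) k
      -- The representatives `u` of the entries of `e` extend to representatives of all of `A`,
      -- where the formula must give the same answer as for `w`.
      let w' := Function.extend h u w
      have hw'h : w' ∘ h = u := funext fun q => hh.extend_apply _ _ _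
      have hw' : IsRep w' := by
        intro e
        by_cases he : ∃ k, (l k).1 = e
        · obtain ⟨k, rfl⟩ := he
          rw [← hu k]
          congr 1
          funext j
          exact congrFun hw'h ⟨k, j⟩
        · rw [← hw e]
          congr 1
          funext j
          exact Function.extend_apply' _ _ _ fun ⟨q, hq⟩ => he ⟨q.1, congrArg Sigma.fst hq⟩
      rw [← hx, hφ w' hw' v, ← key v w', hw'h]
      exact hψ

end Defin

theorem isFormula_iff {m n : ℕ} {s : Fin m → EqSort L C} {t : Fin n → EqSort L C}
    {R : Tuple s → Tuple t → Prop} :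
    IsFormula R ↔ Defin (∅ : Set (Imag L C)) fun p : Tuple s × Tuple t => R p.1 p.2 := by
  have hE : IsEmpty (ParamVar (∅ : Set (Imag L C))) := ⟨fun q => q.1.2⟩
  rw [IsFormula, Set.empty_definable_iff]
  constructor
  · rintro ⟨φ, hφ⟩
    refine ⟨FirstOrder.Language.Formula.relabel Sum.inl φ, fun p _ v => ?_⟩
    rw [FirstOrder.Language.Formula.realize_relabel]
    exact Set.ext_iff.1 hφ v
  · rintro ⟨φ, hφ⟩
    refine ⟨FirstOrder.Language.Formula.relabel (Sum.elim id hE.elim) φ, Set.ext fun v => ?_⟩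
    refine (hφ hE.elim (fun e => e.2.elim) v).trans ?_
    rw [Set.mem_ofPred_eq, FirstOrder.Language.Formula.realize_relabel]
    congr! 1
    funext x
    rcases x with x | x
    · rfl
    · exact hE.elim x

theorem definableOver_iff {m : ℕ} {s : Fin m → EqSort L C} {X : Set (Tuple s)} :
    DefinableOver A X ↔ Defin A fun x => x ∈ X := by
  constructor
  · rintro ⟨n, t, e, R, he, hR, rfl⟩
    exact ((isFormula_iff.1 hR).mono (Set.empty_subset A)).fiber he
  · intro h
    obtain ⟨n, t, e, R, he, hR, h⟩ := h.exists_formula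
    exact ⟨n, t, e, R, he, isFormula_iff.2 hR, Set.ext h⟩

end Definability

/-! ### Real parameters -/

section RealParameters

variable {L : FirstOrder.Language.{u, v}} {C : Type w} [L.Structure C]
variable {A B : Set (Imag L C)} {S S' : Set C} {κ : Cardinal.{w}}
variable {α β γ : Type w} [EqSpace L C α] [EqSpace L C β] [EqSpace L C γ]

/-- `S` contains representatives of all elements of `A`. -/
def Covers (S : Set C) (A : Set (Imag L C)) : Prop :=
  ∃ p : ParamVar A → C, IsRep p ∧ Set.range p ⊆ S

variable (L) in
/-- `S` contains the coordinates of a representative of `c`. -/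
def CoversPt (S : Set C) (c : γ) : Prop :=
  ∃ v : EqSpace.idx L C γ → C, EqSpace.ofRep v = c ∧ Set.range v ⊆ S

theorem Covers.mono (h : Covers S A) (hS : S ⊆ S') : Covers S' A := by
  obtain ⟨p, hp, h⟩ := h
  exact ⟨p, hp, h.trans hS⟩

theorem Covers.mono_right (h : Covers S B) (hAB : A ⊆ B) : Covers S A := by
  obtain ⟨p, hp, h⟩ := h
  exact ⟨fun q => p ⟨⟨q.1.1, hAB q.1.2⟩, q.2⟩, fun e => hp ⟨e.1, hAB e.2⟩,
    fun _ ⟨q, hq⟩ => h ⟨_, hq⟩⟩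

theorem CoversPt.mono {c : γ} (h : CoversPt L S c) (hS : S ⊆ S') : CoversPt L S' c := by
  obtain ⟨p, hp, h⟩ := h
  exact ⟨p, hp, h.trans hS⟩

theorem realSet_mono (h : S ⊆ S') : realSet L S ⊆ realSet L S' := Set.image_mono h

theorem toHome_injective : Function.Injective (toHome L : C → (homeSort L C).Carrier) := by
  intro a b h
  have h' := Quotient.exact h
  change (homeSort L C).rel.Realize _ at h'
  simpa [homeSort] using h'

theorem IsRep.apply_real {p : ParamVar (realSet L S) → C} (hp : IsRep p) {a : C} (ha : a ∈ S)
    (j : Fin (homeSort L C).arity) : p ⟨⟨⟨homeSort L C, toHome L a⟩, ⟨a, ha, rfl⟩⟩, j⟩ = a := by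
  have h := Quotient.exact (hp ⟨⟨homeSort L C, toHome L a⟩, ⟨a, ha, rfl⟩⟩)
  change (homeSort L C).rel.Realize _ at h
  obtain rfl : j = (0 : Fin 1) := Subsingleton.elim (α := Fin 1) _ _
  simpa [homeSort] using h

theorem covers_realSet : Covers S (realSet L S) := by
  obtain ⟨p, hp⟩ := exists_isRep (realSet L S)
  refine ⟨p, hp, ?_⟩
  rintro _ ⟨⟨⟨_, a, ha, rfl⟩, j⟩, rfl⟩
  rwa [hp.apply_real ha]

theorem Defin.definable {P : α → Prop} (h : Defin A P) (hS : Covers S A) :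
    S.Definable L {v : EqSpace.idx L C α → C | P (EqSpace.ofRep v)} := by
  obtain ⟨φ, hφ⟩ := h
  obtain ⟨p, hp, hpS⟩ := hS
  rw [Set.definable_iff_exists_formula_sum]
  refine ⟨φ.relabel (Sum.elim Sum.inr fun q => Sum.inl ⟨p q, hpS ⟨q, rfl⟩⟩), Set.ext fun v => ?_⟩
  refine (hφ p hp v).trans ?_
  rw [Set.mem_ofPred_eq, FirstOrder.Language.Formula.realize_relabel]
  congr! 1
  funext x
  rcases x with _ | _ <;> rfl

/-- Trades imaginary parameters for real ones: the monster's saturation speaks of real parameters,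
so every compactness argument is run over some `realSet L S`. -/
theorem Defin.real {P : γ → α → Prop} (h : Defin A fun p : γ × α => P p.1 p.2) (hS : Covers S A)
    {c : γ} (hc : CoversPt L S c) : Defin (realSet L S) (P c) := by
  obtain ⟨φ, hφ⟩ := h
  obtain ⟨p, hp, hpS⟩ := hS
  obtain ⟨v, rfl, hvS⟩ := hc
  let k : S → ParamVar (realSet L S) := fun a =>
    ⟨⟨⟨homeSort L C, toHome L a⟩, ⟨a, a.2, rfl⟩⟩, (0 : Fin 1)⟩
  refine ⟨FirstOrder.Language.Formula.relabel
    (Sum.elim (Sum.elim (fun i => Sum.inr (k ⟨v i, hvS ⟨i, rfl⟩⟩)) Sum.inl)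
      fun q => Sum.inr (k ⟨p q, hpS ⟨q, rfl⟩⟩)) φ, fun q hq w => ?_⟩
  rw [FirstOrder.Language.Formula.realize_relabel]
  refine (hφ p hp (Sum.elim v w)).trans ?_
  congr! 1
  funext x
  rcases x with (x | x) | x
  · exact (hq.apply_real (hvS ⟨x, rfl⟩) _).symm
  · rfl
  · exact (hq.apply_real (hpS ⟨x, rfl⟩) _).symm

theorem Defin.real' {P : α → Prop} (h : Defin A P) (hS : Covers S A) : Defin (realSet L S) P :=
  Defin.real (γ := PUnit) (c := PUnit.unit) (P := fun _ => P) (h.comp (by fun_prop)) hS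
    ⟨Empty.elim, rfl, by rintro _ ⟨⟨⟩, _⟩⟩

theorem exists_covers (hκ : ℵ₀ < κ) (hA : IsSmall κ A) : ∃ S : Set C, #S < κ ∧ Covers S A := by
  obtain ⟨p, hp⟩ := exists_isRep A
  refine ⟨Set.range p, ?_, p, hp, subset_rfl⟩
  have h₁ : lift.{max u v w} #(Set.range p) ≤ lift.{w} #(ParamVar A) := mk_range_le_lift
  -- Each imaginary contributes finitely many coordinates, and the uncountable `κ` absorbs the
  -- factor `ℕ`.
  have h₂ : #(ParamVar A) ≤ #(A × ℕ) := mk_le_of_injective (f := fun q => (q.1, q.2.1)) (by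
    rintro ⟨e, i⟩ ⟨e', i'⟩ h
    obtain ⟨rfl, h⟩ := Prod.mk.inj h
    exact congrArg (Sigma.mk e) (Fin.ext h))
  have h₃ : #(A × ℕ) < lift.{max u v} κ := by
    have hω : ℵ₀ < lift.{max u v} κ := aleph0_lt_lift.2 hκ
    rw [mk_prod, lift_uzero, mk_nat, lift_aleph0]
    exact mul_lt_of_lt hω.le hA hω
  have h₄ : lift.{w} #(ParamVar A) = #(ParamVar A) := lift_id'.{w, max u v w} _
  have h₅ : lift.{max u v w} κ = lift.{max u v} κ := congrFun lift_umax.{w, max u v} κ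
  refine lift_lt.{w, max u v w}.1 ?_
  rw [h₅]
  exact (h₁.trans (h₄.trans_le h₂)).trans_lt h₃

theorem mk_union_range_lt (hκ : ℵ₀ < κ) (hS : #S < κ) {ι : Type} [Finite ι] (v : ι → C) :
    #(S ∪ Set.range v : Set C) < κ :=
  (mk_union_le _ _).trans_lt (add_lt_of_lt hκ.le hS ((Set.finite_range v).lt_aleph0.trans hκ))

theorem exists_coversPt (hκ : ℵ₀ < κ) (hS : #S < κ) (c : γ) :
    ∃ S', S ⊆ S' ∧ #S' < κ ∧ CoversPt L S' c := by
  obtain ⟨v, hv⟩ := EqSpace.ofRep_surjective (L := L) (C := C) c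
  exact ⟨S ∪ Set.range v, Set.subset_union_left, mk_union_range_lt hκ hS v, v, hv,
    Set.subset_union_right⟩

theorem isSmall_realSet (hS : #S < κ) : IsSmall κ (realSet L S) := by
  have h : lift.{w} #(realSet L S) ≤ lift.{max u v w} #S := mk_image_le_lift
  have h' : lift.{w} #(realSet L S) = #(realSet L S) := lift_id'.{w, max u v w} _
  rw [IsSmall, ← h']
  refine h.trans_lt ?_
  have h₅ : lift.{max u v w} κ = lift.{max u v} κ := congrFun lift_umax.{w, max u v} κ
  rw [← h₅]
  exact lift_lt.2 hS

/-! ### Saturation in several variables -/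

/-- Induction on the number of variables: one-variable saturation finds a first coordinate in the
projections of all finite intersections, and this coordinate then becomes a parameter. -/
theorem IsMonster.saturated_fin (hC : IsMonster L C κ) : ∀ (n : ℕ) (S : Set C), #S < κ →
    ∀ F : Set (Set (Fin n → C)), (∀ X ∈ F, S.Definable L X) →
      (∀ G : Finset (Set (Fin n → C)), (G : Set (Set (Fin n → C))) ⊆ F →
        (⋂₀ (G : Set (Set (Fin n → C)))).Nonempty) →
        (⋂₀ F).Nonempty := by
  classical
  intro n
  induction n with
  | zero =>
    intro S _ F _ hF
    refine ⟨Fin.elim0, fun X hX => ?_⟩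
    obtain ⟨x, hx⟩ := hF {X} (by simpa using hX)
    rw [Subsingleton.elim Fin.elim0 x]
    exact hx X (by simp)
  | succ n ih =>
    intro S hS F hF hfip
    let F₁ : Set (Set C) := {Y | ∃ G : Finset (Set (Fin (n + 1) → C)),
      (G : Set (Set (Fin (n + 1) → C))) ⊆ F ∧ Y = (fun x : Fin (n + 1) → C => x 0) '' ⋂₀ (G : Set (Set (Fin (n + 1) → C)))}
    have hdef : ∀ G : Finset (Set (Fin (n + 1) → C)), (G : Set (Set (Fin (n + 1) → C))) ⊆ F →
        S.Definable L (⋂₀ (G : Set (Set (Fin (n + 1) → C)))) := by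
      intro G hG
      rw [Set.sInter_eq_iInter]
      exact Set.definable_iInter_of_finite fun X => hF _ (hG X.2)
    obtain ⟨c, hc⟩ := hC.saturated S hS F₁ (by
      rintro _ ⟨G, hG, rfl⟩
      have := (hdef G hG).image_comp (fun _ : Fin 1 => (0 : Fin (n + 1)))
      refine (congrArg (S.Definable L) (Set.ext fun x => ?_)).mp this
      constructor
      · rintro ⟨y, hy, rfl⟩
        exact ⟨y, hy, rfl⟩
      · rintro ⟨y, hy, hyx⟩
        exact ⟨y, hy, funext fun i => by rw [Subsingleton.elim i 0]; exact hyx⟩) (by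
      intro G hG
      choose! H hH hH' using hG
      obtain ⟨x, hx⟩ := hfip (G.biUnion H) (by
        intro X hX
        obtain ⟨Y, hY, hX⟩ := Finset.mem_biUnion.1 hX
        exact hH hY hX)
      refine ⟨x 0, fun Y hY => ?_⟩
      rw [hH' hY]
      exact ⟨x, fun X hX => hx X (Finset.mem_biUnion.2 ⟨Y, hY, hX⟩), rfl⟩)
    obtain ⟨x, hx⟩ := ih (insert c S)
      ((mk_insert_le).trans_lt (add_lt_of_lt hC.aleph0_lt.le hS (one_lt_aleph0.trans hC.aleph0_lt)))
      ((fun X => {x : Fin n → C | Fin.cons (α := fun _ => C) c x ∈ X}) '' F) (by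
        rintro _ ⟨X, hX, rfl⟩
        obtain ⟨φ, rfl⟩ := Set.definable_iff_exists_formula_sum.1 (hF X hX)
        refine Set.definable_iff_exists_formula_sum.2 ⟨FirstOrder.Language.Formula.relabel
          (Sum.elim (fun a : S => (Sum.inl ⟨a.1, Set.mem_insert_of_mem _ a.2⟩ :
            (insert c S : Set C) ⊕ Fin n))
            (Fin.cons (Sum.inl ⟨c, Set.mem_insert _ _⟩) Sum.inr)) φ, Set.ext fun x => ?_⟩
        simp only [Set.mem_ofPred_eq, FirstOrder.Language.Formula.realize_relabel]
        congr! 1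
        funext i
        rcases i with i | i
        · rfl
        · refine Fin.cases ?_ (fun i => ?_) i <;> rfl) (by
        intro G hG
        obtain ⟨H, hH, rfl⟩ := Finset.subset_set_image_iff.1 hG
        obtain ⟨x, hx, hxc⟩ := hc _ ⟨H, hH, rfl⟩
        refine ⟨Fin.tail x, ?_⟩
        intro Y hY
        obtain ⟨X, hX, rfl⟩ := Finset.mem_image.1 hY
        change Fin.cons c (Fin.tail x) ∈ X
        rw [← hxc, Fin.cons_self_tail]
        exact hx X hX)
    exact ⟨Fin.cons c x, fun X hX => hx _ ⟨X, hX, rfl⟩⟩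

theorem IsMonster.exists_forall (hC : IsMonster L C κ) (hS : #S < κ) {F : Set (α → Prop)}
    (hF : ∀ P ∈ F, Defin (realSet L S) P)
    (hfip : ∀ G : Set (α → Prop), G.Finite → G ⊆ F → ∃ x, ∀ P ∈ G, P x) :
    ∃ x, ∀ P ∈ F, P x := by
  classical
  obtain ⟨n, ⟨e⟩⟩ := Finite.exists_equiv_fin (EqSpace.idx L C α)
  obtain ⟨x, hx⟩ := hC.saturated_fin n S hS
    ((fun P : α → Prop => {x : Fin n → C | P (EqSpace.ofRep (x ∘ e))}) '' F) (by
      rintro _ ⟨P, hP, rfl⟩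
      exact ((hF P hP).definable covers_realSet).preimage_comp e) (by
      intro G hG
      obtain ⟨H, hH, rfl⟩ := Finset.subset_set_image_iff.1 hG
      obtain ⟨x, hx⟩ := hfip H H.finite_toSet hH
      obtain ⟨v, rfl⟩ := EqSpace.ofRep_surjective (L := L) (C := C) x
      refine ⟨v ∘ e.symm, ?_⟩
      intro Y hY
      obtain ⟨P, hP, rfl⟩ := Finset.mem_image.1 hY
      change P (EqSpace.ofRep ((v ∘ e.symm) ∘ e))
      rw [Function.comp_assoc, e.symm_comp_self]
      exact hx P hP)
  exact ⟨EqSpace.ofRep (x ∘ e), fun P hP => hx _ ⟨P, hP, rfl⟩⟩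

end RealParameters

/-! ### Algebraic closure and types -/

section Algebraic

variable {L : FirstOrder.Language.{u, v}} {C : Type w} [L.Structure C]
variable {A B : Set (Imag L C)} {S S' : Set C} {κ : Cardinal.{w}}
variable {α β γ : Type w} [EqSpace L C α] [EqSpace L C β] [EqSpace L C γ]

/-- `P` has at least `N` solutions. -/
def ManyOf {X : Type*} (N : ℕ) (P : X → Prop) : Prop :=
  ∃ z : Fin N → X, Function.Injective z ∧ ∀ i, P (z i)

/-! ### Counting solutions. -/

section

variable {X : Type*} {P Q : X → Prop} {N N' : ℕ}

theorem ManyOf.of_le (h : ManyOf N P) (hN : N' ≤ N) : ManyOf N' P := by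
  obtain ⟨z, hz, hP⟩ := h
  exact ⟨z ∘ Fin.castLE hN, hz.comp (Fin.castLE_injective hN), fun i => hP _⟩

theorem ManyOf.imp (h : ManyOf N P) (hPQ : ∀ x, P x → Q x) : ManyOf N Q := by
  obtain ⟨z, hz, hP⟩ := h
  exact ⟨z, hz, fun i => hPQ _ (hP i)⟩

theorem manyOf_of_infinite (h : {x | P x}.Infinite) (N : ℕ) : ManyOf N P := by
  have := h.to_subtype
  let f := Infinite.natEmbedding {x | P x}
  exact ⟨fun i => f i, fun i j h => Fin.ext (f.injective (Subtype.ext h)), fun i => (f i).2⟩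

theorem finite_of_not_manyOf (h : ¬ ManyOf N P) : {x | P x}.Finite := by
  by_contra h'
  exact h (manyOf_of_infinite h' N)

theorem exists_not_manyOf (h : {x | P x}.Finite) : ∃ N, ¬ ManyOf N P := by
  refine ⟨{x | P x}.ncard + 1, ?_⟩
  rintro ⟨z, hz, hP⟩
  have h₁ : (Set.range z).ncard ≤ {x | P x}.ncard :=
    Set.ncard_le_ncard (by rintro _ ⟨i, rfl⟩; exact hP i) h
  rw [← Set.image_univ, Set.ncard_image_of_injective _ hz, Set.ncard_univ] at h₁
  simp at h₁

theorem manyOf_card {P : X → Prop} (F : Finset X) (h : ∀ x ∈ F, P x) : ManyOf F.card P :=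
  ⟨fun i => F.equivFin.symm i, fun _ _ hij => F.equivFin.symm.injective (Subtype.ext hij),
    fun i => h _ (F.equivFin.symm i).2⟩

end

/-- Finiteness is not a definable condition, but having at least a fixed number of solutions is;
this lets algebraicity pass along equality of types. -/
theorem Defin.manyOf {P : α → β → Prop} (h : Defin A fun p : α × β => P p.1 p.2) (N : ℕ) :
    Defin A fun x => ManyOf N (P x) := by
  refine ex (P := fun x (z : Fin N → β) => Function.Injective z ∧ ∀ i, P x (z i)) (and ?_ ?_)
  · refine (all (ι := {p : Fin N × Fin N // p.1 ≠ p.2})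
      (P := fun q (p : α × (Fin N → β)) => ¬ p.2 q.1.1 = p.2 q.1.2) fun q =>
        (eq (by fun_prop) (by fun_prop)).not).congr fun p => ?_
    exact ⟨fun h q hq => q.2 (h hq), fun h i j hij => by_contra fun hne => h ⟨(i, j), hne⟩ hij⟩
  · exact all fun i => comp (f := fun p : α × (Fin N → β) => (p.1, p.2 i)) h (by fun_prop)

/-- `a` is algebraic over `A` and `b`. -/
def Acl (A : Set (Imag L C)) (b : β) (a : α) : Prop :=
  ∃ P : β → α → Prop, Defin A (fun p : β × α => P p.1 p.2) ∧ P b a ∧ {x | P b x}.Finite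

/-- `a` and `b` have the same type over `A`. -/
def SameTp (A : Set (Imag L C)) (a b : α) : Prop := ∀ P : α → Prop, Defin A P → (P a ↔ P b)

theorem SameTp.of_imp {a b : α} (h : ∀ P : α → Prop, Defin A P → P a → P b) : SameTp A a b :=
  fun P hP => ⟨h P hP, fun hb => by_contra fun ha => h _ hP.not ha hb⟩

theorem SameTp.mono {a b : α} (h : SameTp B a b) (hAB : A ⊆ B) : SameTp A a b :=
  fun P hP => h P (hP.mono hAB)

theorem SameTp.map {a b : α} (h : SameTp A a b) {f : α → β} (hf : IsProj L C f) :
    SameTp A (f a) (f b) := fun P hP => h (fun x => P (f x)) (hP.comp hf)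

theorem sameType_iff {m : ℕ} {s : Fin m → EqSort L C} {a b : Tuple s} :
    SameType A a b ↔ SameTp A a b :=
  ⟨fun h P hP => h {x | P x} (definableOver_iff.2 hP), fun h _ hX => h _ (definableOver_iff.1 hX)⟩

/-- Adding to the formula the clause that it has fewer than `N` solutions over the given base point
makes the bound uniform. -/
theorem Acl.exists_bounded {b : β} {a : α} (h : Acl A b a) : ∃ (P : β → α → Prop) (N : ℕ),
    Defin A (fun p : β × α => P p.1 p.2) ∧ P b a ∧ ∀ y, ¬ ManyOf N (P y) := by
  obtain ⟨P, hP, hba, hfin⟩ := h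
  obtain ⟨N, hN⟩ := exists_not_manyOf hfin
  refine ⟨fun y x => P y x ∧ ¬ ManyOf N (P y), N,
    hP.and ((hP.manyOf N).comp (f := Prod.fst) (by fun_prop)).not, ⟨hba, hN⟩, fun y hy => ?_⟩
  -- `N = 0` is impossible, as `ManyOf 0` always holds; otherwise a single solution already carries
  -- the bounding clause.
  rcases N with _ | N
  · exact hN ⟨Fin.elim0, fun i => i.elim0, fun i => i.elim0⟩
  · obtain ⟨z, hz, hP⟩ := hy
    exact (hP 0).2 ⟨z, hz, fun i => (hP i).1⟩

theorem Acl.congr {b b' : β} {a a' : α} (h : Acl A b a) (h' : SameTp A (b, a) (b', a')) :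
    Acl A b' a' := by
  obtain ⟨P, N, hP, hba, hN⟩ := h.exists_bounded
  exact ⟨P, hP, (h' _ hP).1 hba, finite_of_not_manyOf (hN b')⟩

theorem acl_congr {b b' : β} {a a' : α} (h' : SameTp A (b, a) (b', a')) :
    Acl A b a ↔ Acl A b' a' :=
  ⟨fun h => h.congr h', fun h => h.congr fun P hP => (h' P hP).symm⟩

theorem Acl.mono {b : β} {a : α} (h : Acl A b a) (hAB : A ⊆ B) : Acl B b a := by
  obtain ⟨P, hP, h⟩ := h
  exact ⟨P, hP.mono hAB, h⟩

/-- Enlarges the base: `f c` is determined by `c`. -/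
theorem Acl.base {f : γ → β} {c : γ} {a : α} (h : Acl A (f c) a) (hf : IsProj L C f) :
    Acl A c a := by
  obtain ⟨P, hP, h⟩ := h
  exact ⟨fun x y => P (f x) y, hP.comp (f := fun p : γ × α => (f p.1, p.2)) (by fun_prop), h⟩

theorem Acl.map {b : β} {a : α} (h : Acl A b a) {f : α → γ} (hf : IsProj L C f) :
    Acl A b (f a) := by
  obtain ⟨P, hP, hba, hfin⟩ := h
  refine ⟨fun x z => ∃ y, P x y ∧ f y = z, Defin.ex (P := fun (p : β × γ) y => P p.1 y ∧ f y = p.2)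
    ((hP.comp (f := fun p : (β × γ) × α => (p.1.1, p.2)) (by fun_prop)).and
      (Defin.eq (by fun_prop) (by fun_prop))), ⟨a, hba, rfl⟩, hfin.image f⟩

theorem Acl.trans {b : β} {c : γ} {a : α} (h : Acl A (b, c) a) (hc : Acl A b c) : Acl A b a := by
  obtain ⟨P, N, hP, hba, hN⟩ := h.exists_bounded
  obtain ⟨Q, hQ, hbc, hfin⟩ := hc
  refine ⟨fun x z => ∃ y, Q x y ∧ P (x, y) z,
    Defin.ex (P := fun (p : β × α) y => Q p.1 y ∧ P (p.1, y) p.2)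
    ((hQ.comp (f := fun p : (β × α) × γ => (p.1.1, p.2)) (by fun_prop)).and
      (hP.comp (f := fun p : (β × α) × γ => ((p.1.1, p.2), p.1.2)) (by fun_prop))),
    ⟨c, hbc, hba⟩, ?_⟩
  refine (hfin.biUnion fun y _ => finite_of_not_manyOf (hN (b, y))).subset ?_
  rintro z ⟨y, hy, hz⟩
  exact Set.mem_biUnion hy hz

theorem Acl.real_pair {c : γ} {b : β} {a : α} (h : Acl A (c, b) a) (hS : Covers S A)
    (hc : CoversPt L S c) : Acl (realSet L S) b a := by
  obtain ⟨P, hP, h⟩ := h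
  exact ⟨fun x y => P (c, x) y, Defin.real (P := fun c (p : β × α) => P (c, p.1) p.2)
    (hP.comp (f := fun p : γ × β × α => ((p.1, p.2.1), p.2.2)) (by fun_prop)) hS hc, h⟩

theorem Acl.real {b : β} {a : α} (h : Acl A b a) (hS : Covers S A) : Acl (realSet L S) b a := by
  obtain ⟨P, hP, h⟩ := h
  exact ⟨P, hP.real' hS, h⟩

theorem isAlgebraicOver_iff {m : ℕ} {s : Fin m → EqSort L C} {a : Tuple s} :
    IsAlgebraicOver A a ↔ Acl A PUnit.unit.{w + 1} a := by
  constructor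
  · rintro ⟨X, hX, hfin, ha⟩
    exact ⟨fun _ x => x ∈ X, (definableOver_iff.1 hX).comp (by fun_prop), ha, hfin⟩
  · rintro ⟨P, hP, ha, hfin⟩
    refine ⟨{x | P PUnit.unit x}, definableOver_iff.2 ?_, hfin, ha⟩
    exact hP.comp (f := fun x : Tuple s => (PUnit.unit, x))
      (IsProj.prodMk L C ⟨Empty.elim, fun _ => rfl⟩ (by fun_prop))

/-- Over a small set, a type in one more variable has a realization which is not algebraic over a
given small set of real parameters unless it is algebraic. -/
theorem IsMonster.exists_sameTp (hC : IsMonster L C κ) (hS : #S < κ) (hA : Covers S A) {x x' : α}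
    (hx : SameTp A x x') (y : β) :
    ∃ y', SameTp A (x, y) (x', y') ∧ (¬ Acl A x y → ¬ Acl (realSet L S) x' y') := by
  obtain ⟨S', hSS', hS', hxS'⟩ := exists_coversPt (L := L) hC.aleph0_lt hS x'
  -- `F₁` transports the type of `y` over `A` and `x` to `x'`. `F₂` excludes the algebraic points
  -- over `S` and `x'`, and is empty when `y` is algebraic.
  let F₁ : Set (β → Prop) := {Q | ∃ P : α → β → Prop, Defin A (fun p : α × β => P p.1 p.2) ∧
    P x y ∧ Q = P x'}
  let F₂ : Set (β → Prop) := {Q | ¬ Acl A x y ∧ ∃ R : α → β → Prop,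
    Defin (realSet L S) (fun p : α × β => R p.1 p.2) ∧ {z | R x' z}.Finite ∧ Q = fun z => ¬ R x' z}
  -- Finitely many conditions amount to one formula of the transported type minus a finite set `E`.
  have key : ∀ G : Set (β → Prop), G.Finite → G ⊆ F₁ ∪ F₂ → ∃ P : α → β → Prop,
      Defin A (fun p : α × β => P p.1 p.2) ∧ P x y ∧ ∃ E : Set β, E.Finite ∧ (Acl A x y → E = ∅) ∧
        ∀ z, P x' z → z ∉ E → ∀ Q ∈ G, Q z := by
    intro G hG
    induction G, hG using Set.Finite.induction_on with
    | empty =>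
      exact fun _ => ⟨fun _ _ => True, Defin.const _, trivial, ∅, Set.finite_empty, fun _ => rfl,
        by simp⟩
    | @insert Q G _ _ ih =>
      intro hQG
      obtain ⟨P, hP, hxy, E, hE, hE', h⟩ := ih ((Set.subset_insert _ _).trans hQG)
      rcases hQG (Set.mem_insert _ _) with ⟨P', hP', hxy', rfl⟩ | ⟨hacl, R, hR, hfin, rfl⟩
      · refine ⟨fun a b => P a b ∧ P' a b, hP.and hP', ⟨hxy, hxy'⟩, E, hE, hE', ?_⟩
        rintro z ⟨hz, hz'⟩ hzE Q (rfl | hQ)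
        · exact hz'
        · exact h z hz hzE Q hQ
      · refine ⟨P, hP, hxy, E ∪ {z | R x' z}, hE.union hfin, fun h => absurd h hacl, ?_⟩
        rintro z hz hzE Q (rfl | hQ)
        · exact fun hz' => hzE (Or.inr hz')
        · exact h z hz (fun hz' => hzE (Or.inl hz')) Q hQ
  obtain ⟨y', hy'⟩ := hC.exists_forall hS' (F := F₁ ∪ F₂) (by
    rintro _ (⟨P, hP, -, rfl⟩ | ⟨-, R, hR, -, rfl⟩)
    · exact hP.real (hA.mono hSS') hxS'
    · exact (hR.real (covers_realSet.mono hSS') hxS').not) (by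
    intro G hG hGF
    obtain ⟨P, hP, hxy, E, hE, hE', h⟩ := key G hG hGF
    by_cases hacl : Acl A x y
    · obtain ⟨z, hz⟩ := (hx (fun x => ∃ z, P x z) (Defin.ex hP)).1 ⟨y, hxy⟩
      exact ⟨z, h z hz (by simp [hE' hacl])⟩
    · have hinf : {z | P x' z}.Infinite := by
        intro hfin
        obtain ⟨N, hN⟩ := exists_not_manyOf hfin
        rw [← hx (fun x => ManyOf N (P x)) (hP.manyOf N)] at hN
        exact hacl ⟨P, hP, hxy, finite_of_not_manyOf hN⟩
      obtain ⟨z, hz, hzE⟩ := (hinf.sdiff hE).nonempty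
      exact ⟨z, h z hz hzE⟩)
  refine ⟨y', SameTp.of_imp fun P hP hxy => hy' (fun z => P (x', z)) (Or.inl
    ⟨fun a b => P (a, b), hP, hxy, rfl⟩), fun hacl ⟨R, hR, hRy, hfin⟩ => ?_⟩
  exact hy' _ (Or.inr ⟨hacl, R, hR, hfin, rfl⟩) hRy

/-! ### Exchange and rank -/

variable (L C) in
/-- Exchange between an element of `C` and an arbitrary tuple, over small sets of real
parameters. -/
def HasExchange (κ : Cardinal.{w}) : Prop :=
  ∀ (S : Set C) (β : Type w) [EqSpace L C β] (d : β) (a : C), #S < κ → Acl (realSet L S) a d →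
    ¬ Acl (realSet L S) PUnit.unit.{w + 1} d → Acl (realSet L S) d a

/-- Exchange passes to imaginary parameters by conjugation: over `A` and `b`, move `d` outside
acl(S) and then, if the conclusion fails, `a` outside acl(Sbd'). Exchange over the real set `S`
rules this out. -/
theorem HasExchange.acl (hE : HasExchange L C κ) (hC : IsMonster L C κ) (hA : IsSmall κ A)
    {b : β} {d : γ} {a : C} (h : Acl A (b, a) d) (hd : ¬ Acl A b d) : Acl A (b, d) a := by
  obtain ⟨S₀, hS₀, hAS₀⟩ := exists_covers hC.aleph0_lt hA
  obtain ⟨S, hSS, hS, hbS⟩ := exists_coversPt (L := L) hC.aleph0_lt hS₀ b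
  have hAS := hAS₀.mono hSS
  obtain ⟨d', hd', hdS⟩ := hC.exists_sameTp hS hAS (fun P _ => Iff.rfl : SameTp A b b) d
  obtain ⟨a', ha', haS⟩ := hC.exists_sameTp hS hAS hd' a
  by_contra hcon
  refine haS hcon (Acl.base (f := fun p : β × γ => p.2) (c := (b, d')) ?_ (by fun_prop))
  have h' : Acl A (b, a') d' := h.congr
    (ha'.map (f := fun p : (β × γ) × C => ((p.1.1, p.2), p.1.2)) (by fun_prop))
  exact hE S γ d' a' hS (h'.real_pair hAS hbS) fun h₁ => hdS hd
    (h₁.base (f := fun _ : β => PUnit.unit.{w + 1}) ⟨Empty.elim, fun _ => rfl⟩)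

open Classical in
/-- The number of entries of a real tuple which are not algebraic over `A` and the entries before
them. -/
noncomputable def rk (A : Set (Imag L C)) : ∀ n : ℕ, (Fin n → C) → ℕ
  | 0, _ => 0
  | n + 1, a => rk A n (fun i => a i.castSucc) +
      if Acl A (fun i : Fin n => a i.castSucc) (a (Fin.last n)) then 0 else 1

theorem rk_le (A : Set (Imag L C)) (n : ℕ) (a : Fin n → C) : rk A n a ≤ n := by
  induction n with
  | zero => exact le_rfl
  | succ n ih =>
    rw [rk]
    have := ih fun i => a i.castSucc
    split_ifs <;> omega

theorem rk_real_le (hS : Covers S A) (n : ℕ) (a : Fin n → C) : rk (realSet L S) n a ≤ rk A n a := by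
  induction n with
  | zero => exact le_rfl
  | succ n ih =>
    rw [rk, rk]
    refine add_le_add (ih _) ?_
    split_ifs with h₁ h₂ h₂
    · exact le_rfl
    · exact zero_le_one
    · exact absurd (h₂.real hS) h₁
    · exact le_rfl

theorem rk_mono (hAB : A ⊆ B) (n : ℕ) (a : Fin n → C) : rk B n a ≤ rk A n a := by
  induction n with
  | zero => exact le_rfl
  | succ n ih =>
    rw [rk, rk]
    refine add_le_add (ih _) ?_
    split_ifs with h₁ h₂ h₂
    · exact le_rfl
    · exact zero_le_one
    · exact absurd (h₂.mono hAB) h₁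
    · exact le_rfl

theorem SameTp.rk_eq {n : ℕ} {a b : Fin n → C} (h : SameTp A a b) : rk A n a = rk A n b := by
  classical
  induction n with
  | zero => rfl
  | succ n ih =>
    rw [rk, rk, ih (h.map (f := fun (x : Fin (n + 1) → C) (i : Fin n) => x i.castSucc)
      (by fun_prop))]
    congr 1
    refine if_congr (acl_congr (h.map (f := fun x : Fin (n + 1) → C =>
      ((fun i : Fin n => x i.castSucc), x (Fin.last n))) (by fun_prop))) rfl rfl

/-- A free extension, built entry by entry: an entry that is non-algebraic over `A` and its
predecessors is realized outside the algebraic closure of `S` and the new predecessors. -/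
theorem IsMonster.exists_sameTp_rk (hC : IsMonster L C κ) (hS : #S < κ) (hA : Covers S A) (n : ℕ)
    (a : Fin n → C) : ∃ b, SameTp A a b ∧ rk A n a ≤ rk (realSet L S) n b := by
  induction n with
  | zero => exact ⟨a, fun P _ => Iff.rfl, le_rfl⟩
  | succ n ih =>
    obtain ⟨x, hx, hrk⟩ := ih fun i => a i.castSucc
    obtain ⟨y, hy, hacl⟩ := hC.exists_sameTp hS hA hx (a (Fin.last n))
    refine ⟨Fin.snoc (α := fun _ => C) x y, ?_, ?_⟩
    · have h := hy.map (f := fun p : (Fin n → C) × C => Fin.snoc (α := fun _ => C) p.1 p.2)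
        (IsProj.pi L C fun i => by
          refine Fin.lastCases ?_ (fun i => ?_) i
          · simp only [Fin.snoc_last]
            fun_prop
          · simp only [Fin.snoc_castSucc]
            fun_prop)
      have ha : Fin.snoc (α := fun _ => C) (fun i : Fin n => a i.castSucc) (a (Fin.last n)) = a :=
        Fin.snoc_init_self a
      dsimp only at h
      rwa [ha] at h
    · simp only [rk, Fin.snoc_castSucc, Fin.snoc_last]
      refine add_le_add hrk ?_
      split_ifs with h₁ h₂ h₂
      · exact le_rfl
      · exact zero_le_one
      · exact absurd h₂ (by simpa only [Fin.snoc_castSucc, Fin.snoc_last] using hacl h₁)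
      · exact le_rfl

/-- At the first entry whose addition makes `d` algebraic, exchange makes that entry algebraic over
`d` and the earlier ones, so it is no longer counted over `S`; the other entries contribute no more
than before. -/
theorem HasExchange.rk_lt (hE : HasExchange L C κ) (hC : IsMonster L C κ) (hA : IsSmall κ A)
    (hS : Covers S A) {c : β} {d : γ} (hc : CoversPt L S c) (hdS : CoversPt L S d)
    (hd : ¬ Acl A c d) (n : ℕ) (a : Fin n → C) (h : Acl A (c, a) d) :
    rk (realSet L S) n a < rk A n a := by
  induction n with
  | zero =>
    refine absurd (h.base (f := fun c : β => (c, a))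
      (IsProj.prodMk L C (by fun_prop) (IsProj.pi L C fun i => i.elim0))) hd
  | succ n ih =>
    rw [rk, rk]
    by_cases hx : Acl A (c, fun i : Fin n => a i.castSucc) d
    · refine add_lt_add_of_lt_of_le (ih _ hx) ?_
      split_ifs with h₁ h₂ h₂
      · exact le_rfl
      · exact zero_le_one
      · exact absurd (h₂.real hS) h₁
      · exact le_rfl
    · refine add_lt_add_of_le_of_lt (rk_real_le hS n _) ?_
      have h' : Acl A ((c, fun i : Fin n => a i.castSucc), a (Fin.last n)) d := by
        refine (Acl.base (f := fun p : (β × (Fin n → C)) × C =>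
          (p.1.1, (Fin.snoc (α := fun _ => C) p.1.2 p.2 : Fin (n + 1) → C))) ?_ ?_)
        · have ha : Fin.snoc (α := fun _ => C) (fun i : Fin n => a i.castSucc) (a (Fin.last n)) = a :=
            Fin.snoc_init_self a
          dsimp only
          rwa [ha]
        · refine IsProj.prodMk L C (by fun_prop) (IsProj.pi L C fun i => ?_)
          refine Fin.lastCases ?_ (fun i => ?_) i
          · simp only [Fin.snoc_last]
            fun_prop
          · simp only [Fin.snoc_castSucc]
            fun_prop
      have hb := hE.acl hC hA h' hx
      have hb' : Acl (realSet L S) (fun i : Fin n => a i.castSucc) (a (Fin.last n)) := by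
        refine Acl.real_pair (c := (c, d)) (hb.base (γ := (β × γ) × (Fin n → C))
          (c := ((c, d), fun i : Fin n => a i.castSucc))
          (f := fun p => ((p.1.1, p.2), p.1.2)) (by fun_prop)) hS ?_
        obtain ⟨v, hv, hvS⟩ := hc
        obtain ⟨v', hv', hvS'⟩ := hdS
        refine ⟨Sum.elim v v', Prod.ext hv hv', ?_⟩
        rintro _ ⟨i | i, rfl⟩
        · exact hvS ⟨i, rfl⟩
        · exact hvS' ⟨i, rfl⟩
      -- Were this entry already algebraic over `A` and its predecessors, transitivity would make
      -- `d` algebraic without it.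
      have hb'' : ¬ Acl A (fun i : Fin n => a i.castSucc) (a (Fin.last n)) := fun hn =>
        hx (Acl.trans h' (hn.base (f := fun p : β × (Fin n → C) => p.2)
          (c := (c, fun i : Fin n => a i.castSucc)) (by fun_prop)))
      rw [if_pos hb', if_neg hb'']
      exact zero_lt_one

end Algebraic

/-! ### Exchange implies superrosiness -/

section Superrosy

variable {L : FirstOrder.Language.{u, v}} {C : Type w} [L.Structure C]
variable {A B : Set (Imag L C)} {S S' : Set C} {κ : Cardinal.{w}}
variable {α β γ : Type w} [EqSpace L C α] [EqSpace L C β] [EqSpace L C γ]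

theorem IsProj.unit : IsProj L C (fun _ : α => PUnit.unit.{w + 1}) := ⟨Empty.elim, fun _ => rfl⟩

theorem coversPt_unit : CoversPt L S PUnit.unit.{w + 1} :=
  ⟨Empty.elim, rfl, by rintro _ ⟨⟨⟩, _⟩⟩

theorem CoversPt.apply {ι : Type} [Finite ι] {α : ι → Type w} [∀ i, EqSpace L C (α i)]
    {x : ∀ i, α i} (h : CoversPt L S x) (i : ι) : CoversPt L S (x i) := by
  obtain ⟨v, rfl, hv⟩ := h
  exact ⟨fun j => v ⟨i, j⟩, rfl, by rintro _ ⟨j, rfl⟩; exact hv ⟨_, rfl⟩⟩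

variable (L C α) in
theorem exists_isProj_surjective :
    ∃ (n : ℕ) (f : (Fin n → C) → α), IsProj L C f ∧ Function.Surjective f := by
  obtain ⟨n, ⟨e⟩⟩ := Finite.exists_equiv_fin (EqSpace.idx L C α)
  refine ⟨n, fun v => EqSpace.ofRep (v ∘ e), ⟨fun i => ⟨e i, ()⟩, fun _ => rfl⟩, fun x => ?_⟩
  obtain ⟨v, rfl⟩ := EqSpace.ofRep_surjective (L := L) (C := C) x
  exact ⟨v ∘ e.symm, by simp [Function.comp_assoc]⟩

theorem IsSmall.union_finite (hκ : ℵ₀ < κ) (hA : IsSmall κ A) (hB : B.Finite) :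
    IsSmall κ (A ∪ B) := by
  have hω : ℵ₀ < lift.{max u v} κ := aleph0_lt_lift.2 hκ
  exact (mk_union_le _ _).trans_lt (add_lt_of_lt hω.le hA (hB.lt_aleph0.trans hω))

theorem Tuple.finite_entries {m : ℕ} {s : Fin m → EqSort L C} (a : Tuple s) : a.entries.Finite :=
  Set.finite_range _

/-- Each new conjugate is taken non-algebraic over real representatives of the previous ones, hence
distinct from them. -/
theorem IsMonster.manyOf_sameTp (hC : IsMonster L C κ) (hA : IsSmall κ A) {e : β} {d : γ}
    (hd : ¬ Acl A e d) (k : ℕ) : ManyOf k fun d' => SameTp A (e, d) (e, d') := by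
  induction k with
  | zero => exact ⟨Fin.elim0, fun i => i.elim0, fun i => i.elim0⟩
  | succ k ih =>
    obtain ⟨z, hz, hzd⟩ := ih
    obtain ⟨S₀, hS₀, hAS₀⟩ := exists_covers hC.aleph0_lt hA
    obtain ⟨S, hSS, hS, hzS⟩ := exists_coversPt (L := L) hC.aleph0_lt hS₀ z
    obtain ⟨d', hd', hacl⟩ := hC.exists_sameTp hS (hAS₀.mono hSS)
      (fun P _ => Iff.rfl : SameTp A e e) d
    refine ⟨Fin.cons d' z, Fin.cons_injective_iff.2 ⟨?_, hz⟩, Fin.cases hd' hzd⟩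
    rintro ⟨i, rfl⟩
    refine hacl hd ⟨fun _ y => y = z i, ?_, rfl, by simp⟩
    exact Defin.real (A := realSet L S) (P := fun c (p : β × γ) => p.2 = c i)
      (Defin.eq (by fun_prop)
        ((IsProj.apply L C i).comp L C (g := fun p : (Fin k → γ) × β × γ => p.1) (by fun_prop)))
      covers_realSet hzS

/-- Otherwise `d` has `k` distinct conjugates over `A` and `e`, and `e` satisfies all the
corresponding instances of `δ`. -/
theorem StronglyDivides.acl (hC : IsMonster L C κ) (hA : IsSmall κ A) {m n : ℕ}
    {s : Fin m → EqSort L C} {t : Fin n → EqSort L C} {δ : Tuple s → Tuple t → Prop} {d : Tuple t}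
    (h : StronglyDivides A δ d) (hδ : IsFormula δ) {e : Tuple s} (hed : δ e d) : Acl A e d := by
  obtain ⟨-, k, hk⟩ := h
  by_contra hd
  obtain ⟨z, hz, hzd⟩ := hC.manyOf_sameTp hA hd k
  have hδ' := (isFormula_iff.1 hδ).mono (Set.empty_subset A)
  refine hk (Finset.univ.map ⟨z, hz⟩) ?_ (by simp) ⟨e, ?_⟩
  · intro x hx
    obtain ⟨i, -, rfl⟩ := Finset.mem_map.1 hx
    exact sameType_iff.2 ((hzd i).map (f := fun p : Tuple s × Tuple t => p.2) (by fun_prop))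
  · intro x hx
    obtain ⟨i, -, rfl⟩ := Finset.mem_map.1 hx
    exact (hzd i _ hδ').1 hed

/-- Pass to a free extension `b` of `a` over `B`, the auxiliary tuples `c i` and the parameters `d
i`. It satisfies one of the þ-dividing formulas, so `d i` is algebraic over `A`, `c i` and `b` but
not over `A` and `c i`, and `rk` drops. -/
theorem HasExchange.rk_lt_of_typeThornForks (hE : HasExchange L C κ) (hC : IsMonster L C κ)
    (hB : IsSmall κ B) (hAB : A ⊆ B) {m n : ℕ} {s : Fin m → EqSort L C} {f : (Fin n → C) → Tuple s}
    (hf : IsProj L C f) {a : Fin n → C} (h : TypeThornForks A B (f a)) : rk B n a < rk A n a := by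
  obtain ⟨X, hX, haX, N, n', t, δ, d, hδ, hXδ⟩ := h
  choose hδ l r c hdiv using hδ
  have hB' : IsSmall κ (B ∪ ⋃ i, (c i).entries) :=
    hB.union_finite hC.aleph0_lt (Set.finite_iUnion fun i => (c i).finite_entries)
  obtain ⟨S₀, hS₀, hBS₀⟩ := exists_covers hC.aleph0_lt hB'
  obtain ⟨S, hSS, hS, hdS⟩ := exists_coversPt (L := L) hC.aleph0_lt hS₀ d
  replace hBS₀ := hBS₀.mono hSS
  obtain ⟨b, hab, hrk⟩ := hC.exists_sameTp_rk hS (hBS₀.mono_right Set.subset_union_left) n a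
  have hbX : f b ∈ X := (hab (fun x => f x ∈ X) ((definableOver_iff.1 hX).comp hf)).1 haX
  obtain ⟨i, hi⟩ := hXδ _ hbX
  have hsub : A ∪ (c i).entries ⊆ B ∪ ⋃ i, (c i).entries :=
    Set.union_subset_union hAB (Set.subset_iUnion (fun i => (c i).entries) i)
  have hsm : IsSmall κ (A ∪ (c i).entries) := (mk_le_mk_of_subset hsub).trans_lt hB'
  have hacl := (hdiv i).acl hC hsm (hδ i) hi
  calc rk B n a ≤ rk (realSet L S) n b := hrk
    _ < rk (A ∪ (c i).entries) n b := by
      refine hE.rk_lt hC hsm (hBS₀.mono_right hsub) coversPt_unit (hdS.apply i)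
        (fun h => (hdiv i).1 (isAlgebraicOver_iff.2 h)) n b ?_
      exact hacl.base (f := fun p : PUnit.{w + 1} × (Fin n → C) => f p.2) (c := (PUnit.unit, b))
        (hf.comp L C (by fun_prop))
    _ ≤ rk A n b := rk_mono Set.subset_union_left n b
    _ = rk A n a := ((hab.mono hAB).rk_eq).symm

/-- Each þ-forking extension costs at least one unit of `rk`. -/
theorem HasExchange.not_uThornGE (hE : HasExchange L C κ) (hC : IsMonster L C κ) {m n : ℕ}
    {s : Fin m → EqSort L C} {f : (Fin n → C) → Tuple s} (hf : IsProj L C f) (N : ℕ) :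
    ∀ (a : Fin n → C) (A : Set (Imag L C)), IsSmall κ A → rk A n a < N →
      ¬ UThornGE.{u, v, w} κ (N : Ordinal) (f a) A := by
  induction N with
  | zero => exact fun a A _ h => absurd h (Nat.not_lt_zero _)
  | succ N ih =>
    intro a A hA hrk h
    rw [UThornGE] at h
    obtain ⟨B, e, hAB, hB, hae, hfork, hU⟩ := h N (by norm_cast; omega)
    obtain ⟨S, hS, hAS⟩ := exists_covers hC.aleph0_lt hA
    -- The realization `e` of the type of `f a` is lifted to a real tuple `b` conjugate to `a`, so
    -- that `rk` is unchanged over `A`.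
    obtain ⟨b, hb, -⟩ := hC.exists_sameTp hS hAS (sameType_iff.1 hae) a
    obtain rfl : f b = e := (hb (fun p => f p.2 = p.1)
      (Defin.eq (hf.comp L C (by fun_prop)) (by fun_prop))).1 rfl
    have h₁ := hE.rk_lt_of_typeThornForks hC hB hAB hf hfork
    have h₂ : rk A n a = rk A n b :=
      (hb.map (f := fun p : Tuple s × (Fin n → C) => p.2) (by fun_prop)).rk_eq
    exact ih b B hB (by omega) hU

/-! ### Thorn-ranks -/

/-- The family `{δ(x, a)}`, `a ⊨ π(y; c)`, is `k`-inconsistent. -/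
def InconsistentAt (δ : α → β → Prop) (π : β → γ → Prop) (k : ℕ) (c : γ) : Prop :=
  ¬ ∃ x, ManyOf k fun a => π a c ∧ δ x a

/-- The approximation of the thorn-rank in which infinitely many instances are replaced by `N`
instances. -/
def FinRankGE {I J : Type*} (δ : I → α → β → Prop) (π : J → β → γ → Prop) (k N : ℕ) :
    ℕ → (α → Prop) → Prop
  | 0, X => ∃ x, X x
  | n + 1, X => ∃ i j c, InconsistentAt (δ i) (π j) k c ∧
      ManyOf N fun a => π j a c ∧ FinRankGE δ π k N n fun x => X x ∧ δ i x a

section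

variable {I J : Type*} {δ : I → α → β → Prop} {π : J → β → γ → Prop} {k N N' n : ℕ}

theorem FinRankGE.of_le (hN : N' ≤ N) : ∀ {n : ℕ} {X : α → Prop}, FinRankGE δ π k N n X →
    FinRankGE δ π k N' n X
  | 0, _, h => h
  | _ + 1, _, ⟨i, j, c, hc, h⟩ =>
    ⟨i, j, c, hc, (h.imp fun _ ha => ⟨ha.1, ha.2.of_le hN⟩).of_le hN⟩

theorem defin_inconsistentAt {δ : α → β → Prop} {π : β → γ → Prop}
    (hδ : Defin A fun p : α × β => δ p.1 p.2) (hπ : Defin A fun p : β × γ => π p.1 p.2) :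
    Defin A (InconsistentAt δ π k) :=
  (Defin.ex (Defin.manyOf (P := fun (p : γ × α) a => π a p.1 ∧ δ p.2 a)
    ((hπ.comp (f := fun p : (γ × α) × β => (p.2, p.1.1)) (by fun_prop)).and
      (hδ.comp (f := fun p : (γ × α) × β => (p.1.2, p.2)) (by fun_prop))) k)).not

/-- Unlike the þ-rank itself, its finite approximations are definable in the parameters, so
saturation applies to them. -/
theorem defin_finRankGE [Finite I] [Finite J] (hδ : ∀ i, Defin A fun p : α × β => δ i p.1 p.2)
    (hπ : ∀ j, Defin A fun p : β × γ => π j p.1 p.2) : ∀ (n : ℕ) {ζ : Type w} [EqSpace L C ζ]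
    {X : ζ → α → Prop}, Defin A (fun p : ζ × α => X p.1 p.2) →
      Defin A fun z => FinRankGE δ π k N n (X z)
  | 0, _, _, _, hX => Defin.ex hX
  | n + 1, ζ, _, X, hX => by
    refine Defin.any fun i => Defin.any fun j => Defin.ex (P := fun z c => _ ∧ _)
      (((defin_inconsistentAt (hδ i) (hπ j)).comp (f := fun p : ζ × γ => p.2) (by fun_prop)).and
        (Defin.manyOf (P := fun (p : ζ × γ) a => π j a p.2 ∧
          FinRankGE δ π k N n fun x => X p.1 x ∧ δ i x a) ?_ N))
    refine ((hπ j).comp (f := fun p : (ζ × γ) × β => (p.2, p.1.2)) (by fun_prop)).and ?_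
    exact defin_finRankGE hδ hπ n (X := fun (p : (ζ × γ) × β) x => X p.1.1 x ∧ δ i x p.2)
      ((hX.comp (f := fun p : ((ζ × γ) × β) × α => (p.1.1.1, p.2)) (by fun_prop)).and
        ((hδ i).comp (f := fun p : ((ζ × γ) × β) × α => (p.2, p.1.2)) (by fun_prop)))

/-- The `P N` decrease, so finitely many conditions reduce to one infinite `P N` minus a finite set.
-/
theorem IsMonster.exists_not_acl (hC : IsMonster L C κ) (hS : #S < κ) {P : ℕ → α → Prop}
    (hP : ∀ N, Defin (realSet L S) (P N)) (hanti : ∀ N N', N ≤ N' → ∀ x, P N' x → P N x)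
    (hinf : ∀ N, {x | P N x}.Infinite) :
    ∃ x, (∀ N, P N x) ∧ ¬ Acl (realSet L S) PUnit.unit.{w + 1} x := by
  let F₂ : Set (α → Prop) := {Q | Defin (realSet L S) Q ∧ {x | ¬ Q x}.Finite}
  have key : ∀ G : Set (α → Prop), G.Finite → G ⊆ Set.range P ∪ F₂ → ∃ N, ∃ E : Set α, E.Finite ∧
      ∀ z, P N z → z ∉ E → ∀ Q ∈ G, Q z := by
    intro G hG
    induction G, hG using Set.Finite.induction_on with
    | empty => exact fun _ => ⟨0, ∅, Set.finite_empty, by simp⟩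
    | @insert Q G _ _ ih =>
      intro hQG
      obtain ⟨N, E, hE, h⟩ := ih ((Set.subset_insert _ _).trans hQG)
      rcases hQG (Set.mem_insert _ _) with ⟨M, rfl⟩ | ⟨-, hfin⟩
      · refine ⟨max N M, E, hE, ?_⟩
        rintro z hz hzE Q (rfl | hQ)
        · exact hanti _ _ (le_max_right _ _) z hz
        · exact h z (hanti _ _ (le_max_left _ _) z hz) hzE Q hQ
      · refine ⟨N, E ∪ {x | ¬ Q x}, hE.union hfin, ?_⟩
        rintro z hz hzE Q' (rfl | hQ)
        · exact by_contra fun hz' => hzE (Or.inr hz')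
        · exact h z hz (fun hz' => hzE (Or.inl hz')) Q' hQ
  obtain ⟨x, hx⟩ := hC.exists_forall hS (F := Set.range P ∪ F₂) (by
    rintro _ (⟨N, rfl⟩ | h)
    · exact hP N
    · exact h.1) (by
    intro G hG hGF
    obtain ⟨N, E, hE, h⟩ := key G hG hGF
    obtain ⟨z, hz, hzE⟩ := ((hinf N).sdiff hE).nonempty
    exact ⟨z, h z hz hzE⟩)
  refine ⟨x, fun N => hx _ (Or.inl ⟨N, rfl⟩), fun ⟨Q, hQ, hQx, hfin⟩ => ?_⟩
  refine hx (fun x => ¬ Q PUnit.unit x) (Or.inr ⟨?_, by simpa using hfin⟩) hQx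
  exact (hQ.comp (f := fun x : α => (PUnit.unit, x)) (IsProj.unit.prodMk L C (by fun_prop))).not

theorem IsMonster.exists_forall_nat (hC : IsMonster L C κ) (hS : #S < κ) {P : ℕ → α → Prop}
    (hP : ∀ N, Defin (realSet L S) (P N)) (hanti : ∀ N N', N ≤ N' → ∀ x, P N' x → P N x)
    (hne : ∀ N, ∃ x, P N x) : ∃ x, ∀ N, P N x := by
  obtain ⟨x, hx⟩ := hC.exists_forall hS (F := Set.range P) (by rintro _ ⟨N, rfl⟩; exact hP N) (by
    intro G hG hGF
    suffices h : ∃ N, ∀ x, P N x → ∀ Q ∈ G, Q x by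
      obtain ⟨N, h⟩ := h
      obtain ⟨x, hx⟩ := hne N
      exact ⟨x, h x hx⟩
    induction G, hG using Set.Finite.induction_on with
    | empty => exact ⟨0, by simp⟩
    | @insert Q G _ _ ih =>
      obtain ⟨N, h⟩ := ih ((Set.subset_insert _ _).trans hGF)
      obtain ⟨M, rfl⟩ := hGF (Set.mem_insert _ _)
      refine ⟨max N M, ?_⟩
      rintro x hx Q (rfl | hQ)
      · exact hanti _ _ (le_max_right _ _) x hx
      · exact h x (hanti _ _ (le_max_left _ _) x hx) Q hQ)
  exact ⟨x, fun N => hx _ ⟨N, rfl⟩⟩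

/-- Saturation supplies one `c` serving all `N`, then an instance `a` that is not algebraic over `c`
and still has approximate rank `n` for all `N`. A solution obtained by induction over `a` gains one
unit of `rk` when `a` is forgotten. -/
theorem HasExchange.exists_le_rk [Finite I] [Finite J] (hE : HasExchange L C κ)
    (hC : IsMonster L C κ) (hδ : ∀ i, Defin (∅ : Set (Imag L C)) fun p : α × β => δ i p.1 p.2)
    (hπ : ∀ j, Defin (∅ : Set (Imag L C)) fun p : β × γ => π j p.1 p.2) {m : ℕ}
    {f : (Fin m → C) → α} (hf : IsProj L C f) (hf' : Function.Surjective f) (n : ℕ) :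
    ∀ (S : Set C) (X : α → Prop), #S < κ → Defin (realSet L S) X →
      (∀ N, FinRankGE δ π k N n X) → ∃ a, X (f a) ∧ n ≤ rk (realSet L S) m a := by
  induction n with
  | zero =>
    intro S X _ _ h
    obtain ⟨x, hx⟩ := h 0
    obtain ⟨a, rfl⟩ := hf' x
    exact ⟨a, hx, Nat.zero_le _⟩
  | succ n ih =>
    intro S X hS hX h
    -- Pigeonhole: if each of the finitely many pairs `(i, j)` failed at some `N`, all would fail at
    -- a common upper bound `M`.
    obtain ⟨i, j, hij⟩ : ∃ i j, ∀ N, ∃ c, InconsistentAt (δ i) (π j) k c ∧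
        ManyOf N fun a => π j a c ∧ FinRankGE δ π k N n fun x => X x ∧ δ i x a := by
      by_contra! hcon
      choose N hN using hcon
      obtain ⟨M, hM⟩ := (Set.finite_range fun p : I × J => N p.1 p.2).bddAbove
      obtain ⟨i, j, c, hc, hm⟩ := h M
      have hle : N i j ≤ M := hM ⟨(i, j), rfl⟩
      exact hN i j c hc ((hm.imp fun _ ha => ⟨ha.1, ha.2.of_le hle⟩).of_le hle)
    have hδ' := fun i => (hδ i).mono (Set.empty_subset (realSet L S))
    have hπ' := fun j => (hπ j).mono (Set.empty_subset (realSet L S))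
    have hfr : ∀ N, Defin (realSet L S) fun a => FinRankGE δ π k N n fun x => X x ∧ δ i x a :=
      fun N => defin_finRankGE hδ' hπ' n (X := fun a x => X x ∧ δ i x a)
        ((hX.comp (f := fun p : β × α => p.2) (by fun_prop)).and
          ((hδ' i).comp (f := fun p : β × α => (p.2, p.1)) (by fun_prop)))
    have hpair : ∀ N, Defin (realSet L S) fun p : γ × β => π j p.2 p.1 ∧
        FinRankGE δ π k N n fun x => X x ∧ δ i x p.2 := fun N =>
      ((hπ' j).comp (f := fun p : γ × β => (p.2, p.1)) (by fun_prop)).and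
        ((hfr N).comp (f := fun p : γ × β => p.2) (by fun_prop))
    obtain ⟨c, hc⟩ := hC.exists_forall_nat hS
      (P := fun N c => InconsistentAt (δ i) (π j) k c ∧
        ManyOf N fun a => π j a c ∧ FinRankGE δ π k N n fun x => X x ∧ δ i x a)
      (fun N => (defin_inconsistentAt (hδ' i) (hπ' j)).and (Defin.manyOf (hpair N) N))
      (fun N N' hN c hc => ⟨hc.1, (hc.2.imp fun _ ha => ⟨ha.1, ha.2.of_le hN⟩).of_le hN⟩) hij
    obtain ⟨S₁, hSS₁, hS₁, hcS₁⟩ := exists_coversPt (L := L) hC.aleph0_lt hS c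
    obtain ⟨a, ha, hacl⟩ := hC.exists_not_acl hS₁
      (P := fun N a => π j a c ∧ FinRankGE δ π k N n fun x => X x ∧ δ i x a)
      (fun N => (hpair N).real (P := fun c a => π j a c ∧
        FinRankGE δ π k N n fun x => X x ∧ δ i x a) (covers_realSet.mono hSS₁) hcS₁)
      (fun N N' hN a ha => ⟨ha.1, ha.2.of_le hN⟩) (by
        intro N hfin
        obtain ⟨M, hM⟩ := exists_not_manyOf hfin
        refine hM (((hc (max N M)).2.imp fun _ ha => ⟨ha.1, ha.2.of_le (le_max_left _ _)⟩).of_le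
          (le_max_right _ _)))
    obtain ⟨S₂, hSS₂, hS₂, haS₂⟩ := exists_coversPt (L := L) hC.aleph0_lt hS₁ a
    obtain ⟨b, ⟨hXb, hδb⟩, hb⟩ := ih S₂ (fun x => X x ∧ δ i x a) hS₂
      ((hX.mono (realSet_mono (hSS₁.trans hSS₂))).and (Defin.real (P := fun a x => δ i x a)
        ((hδ' i).comp (f := fun p : β × α => (p.2, p.1)) (by fun_prop))
        (covers_realSet.mono (hSS₁.trans hSS₂)) haS₂)) fun N => (ha N).2
    refine ⟨b, hXb, ?_⟩
    -- By inconsistency at `c`, fewer than `k` points satisfying `π j` at `c` have an instance true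
    -- of `f b`, and `a` is one of them.
    have hba : Acl (realSet L S₁) (PUnit.unit.{w + 1}, b) a := by
      refine ⟨fun p a' => π j a' c ∧ δ i (f p.2) a', ?_, ⟨(ha 0).1, hδb⟩,
        finite_of_not_manyOf fun h => (hc 0).1 ⟨_, h⟩⟩
      refine Defin.real (A := realSet L S) (P := fun c (p : (PUnit.{w + 1} × (Fin m → C)) × β) =>
        π j p.2 c ∧ δ i (f p.1.2) p.2) (Defin.and ?_ ?_) (covers_realSet.mono hSS₁) hcS₁
      · exact (hπ' j).comp (f := fun p : γ × (PUnit.{w + 1} × (Fin m → C)) × β => (p.2.2, p.1))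
          (by fun_prop)
      · exact (hδ' i).comp
          (f := fun p : γ × (PUnit.{w + 1} × (Fin m → C)) × β => (f p.2.1.2, p.2.2))
          ((hf.comp L C (by fun_prop)).prodMk L C (by fun_prop))
    have h₁ := hE.rk_lt hC (isSmall_realSet hS₁) (covers_realSet.mono hSS₂) coversPt_unit haS₂ hacl
      m b hba
    have h₂ : rk (realSet L S₁) m b ≤ rk (realSet L S) m b := rk_mono (realSet_mono hSS₁) m b
    omega

end

/-- Finite ordinals suffice, because the þ-rank will be bounded by a natural number. -/
theorem ThornRankGE.finRankGE {m n l : ℕ} {s : Fin m → EqSort L C} {t : Fin n → EqSort L C}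
    {r : Fin l → EqSort L C} {Δ : Set (Tuple s → Tuple t → Prop)}
    {P : Set (Tuple t → Tuple r → Prop)} {k : ℕ} (N q : ℕ) : ∀ {X : Set (Tuple s)},
    ThornRankGE.{u, v, w} Δ P k (q : Ordinal) X →
      FinRankGE (fun δ : Δ => δ.1) (fun π : P => π.1) k N q fun x => x ∈ X := by
  induction q with
  | zero =>
    intro X h
    rw [ThornRankGE] at h
    exact h.1
  | succ q ih =>
    intro X h
    rw [ThornRankGE] at h
    obtain ⟨δ, hδ, π, hπ, c, hinf, hk⟩ := h.2 q (by norm_cast; omega)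
    refine ⟨⟨δ, hδ⟩, ⟨π, hπ⟩, c, ?_, (manyOf_of_infinite hinf N).imp fun a ha => ⟨ha.1, ih ha.2⟩⟩
    rintro ⟨x, z, hz, hzx⟩
    refine hk (Finset.univ.map ⟨z, hz⟩) ?_ (by simp) ⟨x, ?_⟩
    · intro y hy
      obtain ⟨i, -, rfl⟩ := Finset.mem_map.1 hy
      exact (hzx i).1
    · intro y hy
      obtain ⟨i, -, rfl⟩ := Finset.mem_map.1 hy
      exact (hzx i).2

/-- With `q` real coordinates representing the sort, `rk` is at most `q`, so neither rank reaches `q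
+ 1`. -/
theorem HasExchange.isSuperrosy (hE : HasExchange L C κ) (hC : IsMonster L C κ) :
    IsSuperrosy L C κ := by
  constructor
  · intro m n l s t r Δ P k X hΔ hP hδ hπ hX
    obtain ⟨q, f, hf, hf'⟩ := exists_isProj_surjective L C (Tuple s)
    refine ⟨((q + 1 : ℕ) : Ordinal), fun h => ?_⟩
    obtain ⟨_, t', e, R, -, hR, rfl⟩ := hX
    have := hΔ.to_subtype
    have := hP.to_subtype
    obtain ⟨S, -, hS, heS⟩ := exists_coversPt (L := L) (C := C) (S := ∅) hC.aleph0_lt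
      (by simpa using hC.aleph0_lt.bot_lt) e
    obtain ⟨a, -, ha⟩ := hE.exists_le_rk hC (δ := fun δ : Δ => δ.1) (π := fun π : P => π.1) (k := k)
      (fun i => isFormula_iff.1 (hδ i i.2)) (fun j => isFormula_iff.1 (hπ j j.2)) hf hf' (q + 1) S
      (fun x => R x e) hS
      (Defin.real (P := fun e x => R x e) (((isFormula_iff.1 hR).mono
        (Set.empty_subset (realSet L S))).comp (f := fun p : Tuple t' × Tuple s => (p.2, p.1))
          (by fun_prop)) covers_realSet heS) fun N => h.finRankGE N _
    have := rk_le (realSet L S) q a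
    omega
  · intro m s e A hA
    obtain ⟨q, f, hf, hf'⟩ := exists_isProj_surjective L C (Tuple s)
    obtain ⟨a, rfl⟩ := hf' e
    exact ⟨_, hE.not_uThornGE hC hf (q + 1) a A hA (Nat.lt_succ_of_le (rk_le A q a))⟩

end Superrosy

/-! ### Exchange from the hypotheses on single elements -/

section Singles

variable {L : FirstOrder.Language.{u, v}} {C : Type w} [L.Structure C]
variable {A B : Set (Imag L C)} {S : Set C} {κ : Cardinal.{w}}
variable {α β : Type w} [EqSpace L C α] [EqSpace L C β]

variable (L C α) in
/-- Every interpreted sort is definably isomorphic to a sort of `C^eq`. -/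
theorem exists_code : ∃ (σ : EqSort L C) (g : α ≃ Tuple fun _ : Fin 1 => σ),
    IsProj L C g ∧ IsProj L C g.symm := by
  obtain ⟨n, ⟨e⟩⟩ := Finite.exists_equiv_fin (EqSpace.idx L C α)
  obtain ⟨φ, hφ⟩ := EqSpace.exists_ker (L := L) (C := C) (α := α)
  have hrel : ∀ a b : Fin n → C, (φ.relabel (Sum.map e e)).Realize (Sum.elim a b) ↔
      (EqSpace.ofRep (L := L) (a ∘ e) : α) = EqSpace.ofRep (b ∘ e) := fun a b => by
    rw [FirstOrder.Language.Formula.realize_relabel, Sum.elim_comp_map, hφ]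
  let σ : EqSort L C :=
    { arity := n
      rel := φ.relabel (Sum.map e e)
      equiv := by
        simp only [hrel]
        exact ⟨fun _ => rfl, fun h => h.symm, fun h h' => h.trans h'⟩ }
  let g' : (Tuple fun _ : Fin 1 => σ) → α := fun y =>
    Quotient.lift (s := σ.setoid) (fun a : Fin n → C => (EqSpace.ofRep (L := L) (a ∘ e) : α))
      (fun a b h => (hrel a b).1 h) (y 0)
  have hinj : Function.Injective g' := by
    intro x y hxy
    funext i
    obtain rfl := Subsingleton.elim i 0
    obtain ⟨a, ha⟩ := Quotient.mk_surjective (s := σ.setoid) (x 0)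
    obtain ⟨b, hb⟩ := Quotient.mk_surjective (s := σ.setoid) (y 0)
    simp only [g', ← ha, ← hb, Quotient.lift_mk] at hxy
    rw [← ha, ← hb]
    exact Quotient.sound ((hrel a b).2 hxy)
  have hval : ∀ v : EqSpace.idx L C α → C,
      g' (fun _ => Quotient.mk σ.setoid (v ∘ e.symm)) = EqSpace.ofRep v := by
    intro v
    change EqSpace.ofRep ((v ∘ e.symm) ∘ e) = _
    rw [Function.comp_assoc, e.symm_comp_self, Function.comp_id]
  have hsurj : Function.Surjective g' := by
    intro x
    obtain ⟨v, rfl⟩ := EqSpace.ofRep_surjective (L := L) (C := C) x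
    exact ⟨fun _ => Quotient.mk σ.setoid (v ∘ e.symm), hval v⟩
  refine ⟨σ, (Equiv.ofBijective g' ⟨hinj, hsurj⟩).symm, ⟨fun p => e.symm p.2, fun v => ?_⟩,
    ⟨fun i => ⟨0, e i⟩, fun v => rfl⟩⟩
  rw [Equiv.symm_apply_eq]
  exact (hval v).symm

theorem isProj_single : IsProj L C (single L : C → _) := ⟨fun _ => (), fun _ => rfl⟩

theorem single_injective : Function.Injective (single L : C → _) := fun _ _ h =>
  toHome_injective (congrFun h 0)

theorem single_surjective : Function.Surjective (single L : C → _) := by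
  intro x
  obtain ⟨a, ha⟩ := Quotient.mk_surjective (s := (homeSort L C).setoid) (x 0)
  refine ⟨a (0 : Fin 1), funext fun i => ?_⟩
  obtain rfl := Subsingleton.elim i 0
  rw [← ha]
  change Quotient.mk (homeSort L C).setoid _ = _
  congr 1
  funext j
  exact congrArg a (Subsingleton.elim (α := Fin 1) _ _)

theorem Acl.of_entries {n : ℕ} {r : Fin n → EqSort L C} {e : Tuple r}
    (he : e.entries ⊆ A) (b : β) : Acl A b e :=
  ⟨fun _ y => y = e, Defin.fiber (P := fun (p : β × Tuple r) z => p.2 = z)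
    (Defin.eq (by fun_prop) (by fun_prop)) he, rfl, by simp⟩

/-- If `d` is algebraic over `S` and `a` but not over `S`, then some formula satisfied by `a`
thorn-divides over every subset of `S`. Its parameter `D` codes `d` with parameters from `S`. -/
theorem exists_thornDivides {a : C} {d : β} (had : Acl (realSet L S) a d)
    (hd : ¬ Acl (realSet L S) PUnit.unit.{w + 1} d) :
    ∃ (σ : EqSort L C) (δ : (Tuple fun _ : Fin 1 => homeSort L C) →
      (Tuple fun _ : Fin 1 => σ) → Prop) (D : Tuple fun _ : Fin 1 => σ),
      IsFormula δ ∧ δ (single L a) D ∧ (∀ A ⊆ realSet L S, ThornDivides A δ D) ∧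
        (Acl (realSet L S) D a → Acl (realSet L S) d a) := by
  obtain ⟨P, M, hP, hPad, hM⟩ := had.exists_bounded
  obtain ⟨n, t, e, R, he, hR, hPR⟩ := hP.exists_formula
  obtain ⟨σ, g, hg, hg'⟩ := exists_code L C (β × Tuple t)
  have hδ : Defin (∅ : Set (Imag L C)) fun p : (Tuple fun _ : Fin 1 => homeSort L C) ×
      (Tuple fun _ : Fin 1 => σ) =>
        ∃ a, single L a = p.1 ∧ R (a, (g.symm p.2).1) (g.symm p.2).2 := by
    refine Defin.ex (P := fun (p : (Tuple fun _ : Fin 1 => homeSort L C) ×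
      (Tuple fun _ : Fin 1 => σ)) a =>
        single L a = p.1 ∧ R (a, (g.symm p.2).1) (g.symm p.2).2) (Defin.and ?_ ?_)
    · exact Defin.eq (isProj_single.comp L C (by fun_prop)) (by fun_prop)
    · have h : IsProj L C fun p : ((Tuple fun _ : Fin 1 => homeSort L C) ×
        (Tuple fun _ : Fin 1 => σ)) × C => g.symm p.1.2 := hg'.comp L C (by fun_prop)
      exact hR.comp (f := fun p : ((Tuple fun _ : Fin 1 => homeSort L C) ×
        (Tuple fun _ : Fin 1 => σ)) × C => ((p.2, (g.symm p.1.2).1), (g.symm p.1.2).2))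
        (((IsProj.snd L C (IsProj.id' L C)).prodMk L C (h.fst L C)).prodMk L C (h.snd L C))
  -- Packing the parameters `e` of `P` into the code makes `δ` parameter-free. Also `e` is the extra
  -- tuple over which strong dividing is tested, so conjugates of the code keep this component and
  -- `M` of them would give `M` solutions of one fibre of `P`.
  refine ⟨σ, fun x y => ∃ a, single L a = x ∧ R (a, (g.symm y).1) (g.symm y).2, g (d, e),
    isFormula_iff.2 hδ, ⟨a, rfl, ?_⟩, fun A hA => ⟨n, t, e, ?_, M, ?_⟩, fun h => ?_⟩
  · rw [g.symm_apply_apply]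
    exact (hPR (a, d)).1 hPad
  · intro halg
    have h := ((isAlgebraicOver_iff.1 halg).mono (Set.union_subset hA he)).map
      (f := fun y => (g.symm y).1) (hg'.fst L C)
    rw [g.symm_apply_apply] at h
    exact hd h
  · rintro F hF hcard ⟨x, hx⟩
    obtain ⟨a, rfl⟩ := single_surjective x
    obtain ⟨z, hz, hzF⟩ : ManyOf M fun y => y ∈ F := hcard ▸ manyOf_card F fun _ h => h
    have hze : ∀ i, (g.symm (z i)).2 = e := by
      intro i
      have h := hF (hzF i)
      refine (sameType_iff.1 h (fun y => (g.symm y).2 = e) (Defin.fiber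
        (P := fun (y : Tuple fun _ : Fin 1 => σ) e' => (g.symm y).2 = e') (Defin.eq
          (IsProj.snd L C (hg'.comp L C (by fun_prop))) (by fun_prop))
        Set.subset_union_right)).1 ?_
      rw [g.symm_apply_apply]
    refine hM a ⟨fun i => (g.symm (z i)).1, fun i j hij => hz (g.symm.injective
      (Prod.ext hij ((hze i).trans (hze j).symm))), fun i => ?_⟩
    obtain ⟨a', ha', hR'⟩ := hx _ (hzF i)
    obtain rfl := single_injective ha'
    rw [hze] at hR'
    exact (hPR (a', _)).2 hR'
  · exact (h.base hg).trans (Acl.of_entries he d)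

/-- If exchange fails, then some non-algebraic type of a single element thorn-forks over all subsets
of a set of real parameters contained in its domain. -/
theorem IsMonster.exists_forks_of_not_hasExchange (hC : IsMonster L C κ)
    (h : ¬ HasExchange L C κ) : ∃ (S S' : Set C) (a : C), S ⊆ S' ∧ #S < κ ∧ #S' < κ ∧
      ¬ IsAlgebraicOver (realSet L S') (single L a) ∧
      ∀ A ⊆ realSet L S, TypeThornForks A (realSet L S') (single L a) := by
  simp only [HasExchange, not_forall] at h
  obtain ⟨S, β, _, d, a, hS, had, hd, hda⟩ := h
  obtain ⟨σ, δ, D, hδ, hδa, hdiv, hD⟩ := exists_thornDivides had hd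
  obtain ⟨S', hSS', hS', hDS'⟩ := exists_coversPt (L := L) hC.aleph0_lt hS D
  -- A conjugate of `a` over `S` and the code `D`, so `δ` still holds; it avoids the algebraic
  -- closure of `S'` because `a` is not algebraic over `S` and `D`.
  obtain ⟨a', ha', hacl⟩ := hC.exists_sameTp hS' (covers_realSet.mono hSS')
    (fun P _ => Iff.rfl : SameTp (realSet L S) D D) a
  have hδ₀ := isFormula_iff.1 hδ
  refine ⟨S, S', a', hSS', hS, hS', fun halg => ?_, fun A hA => ⟨{x | δ x D}, ?_, ?_, ?_⟩⟩
  · obtain ⟨P, hP, hPa, hfin⟩ := isAlgebraicOver_iff.1 halg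
    refine hacl (fun h => hda (hD h)) ⟨fun _ x => P PUnit.unit (single L x), ?_, hPa,
      hfin.preimage single_injective.injOn⟩
    exact hP.comp (f := fun p : (Tuple fun _ : Fin 1 => σ) × C => (PUnit.unit, single L p.2))
      (IsProj.unit.prodMk L C (isProj_single.comp L C (by fun_prop)))
  · exact definableOver_iff.2 (Defin.real (P := fun D x => δ x D)
      ((hδ₀.mono (Set.empty_subset (realSet L S'))).comp
        (f := fun p : (Tuple fun _ : Fin 1 => σ) × (Tuple fun _ : Fin 1 => homeSort L C) =>
          (p.2, p.1)) (by fun_prop)) covers_realSet hDS')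
  · exact (ha' (fun p => δ (single L p.2) p.1) ((hδ₀.mono (Set.empty_subset (realSet L S))).comp
      (f := fun p : (Tuple fun _ : Fin 1 => σ) × C => (single L p.2, p.1))
      ((isProj_single.comp L C (by fun_prop)).prodMk L C (by fun_prop)))).1 hδa
  · exact ⟨1, fun _ => 1, fun _ _ => σ, fun _ => δ, fun _ => D, fun _ => ⟨hδ, hdiv A hA⟩,
      fun x hx => ⟨0, hx⟩⟩

/-- The formula x = a is 2-inconsistent over the conjugates of a non-algebraic a. -/
theorem typeThornForks_self {a : C} (h : ¬ IsAlgebraicOver A (single L a)) :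
    TypeThornForks A (A ∪ (single L a).entries) (single L a) := by
  have heq : IsFormula fun x y : Tuple fun _ : Fin 1 => homeSort L C => x = y :=
    isFormula_iff.2 (Defin.eq (by fun_prop) (by fun_prop))
  refine ⟨{x | x = single L a}, ⟨1, _, single L a, _, Set.subset_union_right, heq, rfl⟩, rfl, 1,
    fun _ => 1, fun _ _ => homeSort L C, fun _ x y => x = y, fun _ => single L a,
    fun _ => ⟨heq, 0, Fin.elim0, fun i => i.elim0, ?_, 2, ?_⟩, fun x hx => ⟨0, hx⟩⟩
  · rwa [Tuple.entries, Set.range_eq_empty, Set.union_empty]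
  · rintro F - hcard ⟨x, hx⟩
    have hF : F ⊆ {x} := fun y hy => Finset.mem_singleton.2 (hx y hy).symm
    have := Finset.card_le_card hF
    rw [Finset.card_singleton] at this
    omega

/-- Otherwise `S`, `S'` and `S'` with `a` adjoined form a chain of two þ-forking extensions, giving
U^þ at least 2. -/
theorem IsMonster.hasExchange_of_uThornLE (hC : IsMonster L C κ)
    (h : ∀ (a : C) (A : Set C), #A < κ →
      UThornLE.{u, v, w} κ 1 (single L a) (realSet L A)) : HasExchange L C κ := by
  by_contra hE
  obtain ⟨S, S', a, hSS', hS, hS', hacl, hfork⟩ := hC.exists_forks_of_not_hasExchange hE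
  refine h a S hS ?_
  rw [UThornGE]
  intro β hβ
  refine ⟨realSet L S', single L a, realSet_mono hSS', isSmall_realSet hS', fun _ _ => Iff.rfl,
    hfork _ subset_rfl, ?_⟩
  rw [UThornGE]
  intro γ hγ
  -- Here `β ≤ 1`, so only `γ = 0` occurs and the rank condition left at the end is vacuous.
  have hγ0 : γ = 0 := by
    have h₁ : β ≤ 1 := Order.lt_add_one_iff.1 hβ
    exact Order.lt_one_iff.1 (hγ.trans_le h₁)
  refine ⟨realSet L S' ∪ (single L a).entries, single L a, Set.subset_union_left,
    (isSmall_realSet hS').union_finite hC.aleph0_lt (Tuple.finite_entries _), fun _ _ => Iff.rfl,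
    typeThornForks_self hacl, ?_⟩
  rw [UThornGE, hγ0]
  exact fun β hβ => absurd hβ not_lt_zero

/-- The type over `S'` þ-forks over ∅, so þ-minimality would make `a` algebraic over `S'`. -/
theorem IsMonster.hasExchange_of_isThornMinimal (hC : IsMonster L C κ)
    (h : IsThornMinimal L C κ) : HasExchange L C κ := by
  by_contra hE
  obtain ⟨S, S', a, hSS', hS, hS', hacl, hfork⟩ := hC.exists_forks_of_not_hasExchange hE
  refine hacl ((h a S' hS' fun h₀ => hacl ?_).1 (hfork ∅ (Set.empty_subset _)))
  exact isAlgebraicOver_iff.2 ((isAlgebraicOver_iff.1 h₀).mono (Set.empty_subset _))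

end Singles

end Thorn

theorem mainTheorem4 {L : FirstOrder.Language.{u, v}} (T : L.Theory) (hT : T.IsComplete)
    (C : Type w) [L.Structure C] [Nonempty C] (hCT : C ⊨ T)
    (κ : Cardinal.{w}) (hC : Thorn.IsMonster L C κ) :
    ((∀ (a : C) (A : Set C), #A < κ →
        Thorn.UThornLE κ 1 (Thorn.single L a) (Thorn.realSet L A)) →
      Thorn.IsSuperrosy L C κ) ∧
    (Thorn.IsThornMinimal L C κ → Thorn.IsSuperrosy L C κ) :=
  ⟨fun h => (hC.hasExchange_of_uThornLE h).isSuperrosy hC,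
    fun h => (hC.hasExchange_of_isThornMinimal h).isSuperrosy hC⟩
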